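/- Let $\mathcal G$ be the space of Lipschitz functions $f:\mathbb R\to\mathbb R$ with the norm $|f(0)|+L_f$, where $L_f=\sup_{x\ne y}|f(y)-f(x)|/|x-y|$, and with its Borel $\sigma$-algebra. Let $\nu$ be a probability measure on $\mathcal G$ such that, for a random $f$ with distribution $\nu$ and some fixed $z_0\in\mathbb R$, $$\mathbf E L_f<\infty,\qquad \mathbf E\log L_f\in[-\infty,0),\qquad \mathbf E|f(z_0)-z_0|<\infty .$$ Let $Z_\infty=\lim_{n\to\infty} f_1\circ\cdots\circ f_n(z_0)$ for i.i.d. $f_1,f_2,\dots$ with distribution $\nu$. Let $\mathcal P$ be a Poisson process on $[0,\infty)\times[0,\infty)\times\mathcal G$ with intensity measure $\mathrm{Leb}\otimes\mathrm{Leb}\otimes\nu$. For $x>0$ and $t>0$ let $(t_1,x_1,g_1),\dots,(t_N,x_N,g_N)$ be the points of $\mathcal P$ in $[0,t]\times[0,x]\times\mathcal G$, listed so that $t_1<\dots<t_N$, and put $\zeta_t(x)=g_1\circ\cdots\circ g_N(z_0)$ (which is $z_0$ if $N=0$) and $\zeta(x)=\lim_{t\to\infty}\zeta_t(x)$. Write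 $\Phi(p)=\mathbf E L_f^p$ and $$V_p(\zeta;[a,b])=\sup_{a\le u_0\le u_1\le\dots\le u_n\le b}\ \sum_{i=0}^{n-1}|\zeta(u_{i+1})-\zeta(u_i)|^p .$$ Let $p\in(0,1]$ with $\Phi(p)<1$, and let $0<a\le b<\infty$. Then the limit defining $Z_\infty$ exists almost surely, almost surely the limits defining $\zeta(x)$ exist for all $x>0$ simultaneously, $\mathbf E|Z_\infty|^p<\infty$, $V_p(\zeta;[a,b])$ is almost surely equal to a random variable, and $$\mathbf E V_p(\zeta;[a,b])\le \log(b/a)\,\frac{2\,\mathbf E|Z_\infty|^p}{1-\Phi(p)} .$$ -/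

import Mathlib

open MeasureTheory ProbabilityTheory Filter Topology
open scoped NNReal ENNReal

noncomputable section

/-! ### The space of Lipschitz functions on the line -/

/-- The Lipschitz functions, as a subspace of the space of all functions `ℝ → ℝ`. -/
def lipSubmodule : Submodule ℝ (ℝ → ℝ) where
  carrier := {f | ∃ K : ℝ≥0, LipschitzWith K f}
  add_mem' := by
    rintro f g ⟨K, hf⟩ ⟨K', hg⟩
    exact ⟨K + K', hf.add hg⟩
  zero_mem' := ⟨0, LipschitzWith.const 0⟩
  smul_mem' := by
    rintro c f ⟨K, hf⟩
    refine ⟨‖c‖₊ * K, LipschitzWith.of_dist_le_mul fun x y => ?_⟩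
    have h := hf.dist_le_mul x y
    simp only [Pi.smul_apply, smul_eq_mul, Real.dist_eq] at h ⊢
    rw [← mul_sub, abs_mul]
    push_cast
    rw [Real.norm_eq_abs, mul_assoc]
    exact mul_le_mul_of_nonneg_left h (abs_nonneg c)

/-- The space `𝒢` of Lipschitz functions `f : ℝ → ℝ`. (A type of its own, so that it carries the
topology of the Lipschitz norm and not that of pointwise convergence.) -/
def LipFun : Type := lipSubmodule

instance : AddCommGroup LipFun := inferInstanceAs (AddCommGroup lipSubmodule)

instance : CoeFun LipFun (fun _ => ℝ → ℝ) := ⟨fun f => f.1⟩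

/-- The Lipschitz constant `L_f = sup_{x ≠ y} |f y - f x| / |x - y|`. -/
def lipConst (f : LipFun) : ℝ :=
  ⨆ q : {q : ℝ × ℝ // q.1 ≠ q.2}, |f q.1.2 - f q.1.1| / |q.1.1 - q.1.2|

instance : Nonempty {q : ℝ × ℝ // q.1 ≠ q.2} := ⟨⟨(0, 1), zero_ne_one⟩⟩

theorem lipConst_bddAbove (f : LipFun) :
    BddAbove (Set.range fun q : {q : ℝ × ℝ // q.1 ≠ q.2} =>
      |f q.1.2 - f q.1.1| / |q.1.1 - q.1.2|) := by
  obtain ⟨K, hK⟩ := f.2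
  refine ⟨K, ?_⟩
  rintro _ ⟨⟨⟨x, y⟩, hxy⟩, rfl⟩
  have h := hK.dist_le_mul y x
  rw [Real.dist_eq, Real.dist_eq, abs_sub_comm y x] at h
  exact (div_le_iff₀ (abs_pos.2 (sub_ne_zero.2 hxy))).2 h

theorem lipConst_nonneg (f : LipFun) : 0 ≤ lipConst f :=
  Real.iSup_nonneg fun _ => by positivity

theorem abs_sub_le_lipConst (f : LipFun) (x y : ℝ) :
    |f y - f x| ≤ lipConst f * |x - y| := by
  by_cases hxy : x = y
  · simp [hxy]
  · exact (div_le_iff₀ (abs_pos.2 (sub_ne_zero.2 hxy))).1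
      (le_ciSup (lipConst_bddAbove f) ⟨(x, y), hxy⟩)

/-- The Lipschitz norm `‖f‖_Lip = |f 0| + L_f`. -/
def lipNorm : AddGroupNorm LipFun where
  toFun f := |f 0| + lipConst f
  map_zero' := by
    change |(0 : ℝ)| + (⨆ q : {q : ℝ × ℝ // q.1 ≠ q.2}, |(0 : ℝ) - 0| / |q.1.1 - q.1.2|) = 0
    simp
  add_le' f g := by
    have h : lipConst (f + g) ≤ lipConst f + lipConst g := by
      refine ciSup_le ?_
      rintro ⟨⟨x, y⟩, hxy⟩
      rw [div_le_iff₀ (abs_pos.2 (sub_ne_zero.2 hxy)), add_mul]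
      refine le_trans ?_ (add_le_add (abs_sub_le_lipConst f x y) (abs_sub_le_lipConst g x y))
      refine le_trans (le_of_eq ?_) (abs_add_le _ _)
      congr 1
      change (f y + g y) - (f x + g x) = _
      ring
    have h0 : |(f + g) 0| ≤ |f 0| + |g 0| := abs_add_le _ _
    linarith
  neg' f := by
    have h : lipConst (-f) = lipConst f := by
      refine congrArg iSup (funext fun q => ?_)
      change |-f q.1.2 - -f q.1.1| / _ = _
      rw [← neg_sub', abs_neg]
    rw [h]
    change |-f 0| + _ = _
    rw [abs_neg]
  eq_zero_of_map_eq_zero' f hf := by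
    have h1 := lipConst_nonneg f
    have h2 := abs_nonneg (f 0)
    have h3 : lipConst f = 0 := by linarith
    have h4 : f 0 = 0 := abs_eq_zero.1 (by linarith)
    refine Subtype.ext (funext fun y => ?_)
    have h5 := abs_sub_le_lipConst f 0 y
    rw [h3, zero_mul, h4, sub_zero] at h5
    exact abs_eq_zero.1 (le_antisymm h5 (abs_nonneg _))

instance : NormedAddCommGroup LipFun := lipNorm.toNormedAddCommGroup

instance : MeasurableSpace LipFun := borel LipFun

instance : BorelSpace LipFun := ⟨rfl⟩

/-! ### Random Lipschitz functions -/

/-- `Φ(p) = E L_f ^ p` for a random function `f` with distribution `ν`. -/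
def lipMoment (ν : Measure LipFun) (p : ℝ) : ℝ≥0∞ :=
  ∫⁻ f, ENNReal.ofReal (lipConst f ^ p) ∂ν

/-- The logarithm of `L_f` with `log 0 = -∞`. -/
def logLip (f : LipFun) : EReal := ENNReal.log (ENNReal.ofReal (lipConst f))

/-- The standing assumptions on the distribution `ν` of the random Lipschitz function `f`:
`E L_f < ∞`, `E log L_f ∈ [-∞, 0)` and `E |f z₀ - z₀| < ∞`. As `log⁺ L_f ≤ L_f`, the first one
gives `E log⁺ L_f < ∞`, so that `E log L_f = E log⁺ L_f - E log⁻ L_f` is well defined and is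
negative exactly when `E log⁺ L_f < E log⁻ L_f`. -/
structure IsContractive (ν : Measure LipFun) (z₀ : ℝ) : Prop where
  moment_lt_top : ∫⁻ f, ENNReal.ofReal (lipConst f) ∂ν < ∞
  log_neg : ∫⁻ f, (logLip f).toENNReal ∂ν < ∫⁻ f, (-logLip f).toENNReal ∂ν
  displacement_lt_top : ∫⁻ f, ENNReal.ofReal |f z₀ - z₀| ∂ν < ∞

/-- The composition `f₁ ∘ f₂ ∘ ⋯ ∘ fₙ` of a list `[f₁, f₂, …, fₙ]`, evaluated at `z`. -/
def composeAt (l : List LipFun) (z : ℝ) : ℝ := l.foldr (fun f w => f w) z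

/-- The backward iteration `Z_n = f₁ ∘ ⋯ ∘ fₙ (z₀)` of a sequence (whose first term has index
`0`). -/
def backwardIter (f : ℕ → LipFun) (z₀ : ℝ) (n : ℕ) : ℝ :=
  composeAt ((List.range n).map f) z₀

/-- The limit `Z_∞` of the backward iterations. -/
def backwardLimit (f : ℕ → LipFun) (z₀ : ℝ) : ℝ :=
  limUnder atTop (backwardIter f z₀)

/-! ### Poisson processes -/

/-- The number of points of the sequence `Y` that lie in `B`. -/
def pointCount {E : Type*} (Y : ℕ → E) (B : Set E) : ℕ∞ := {k | Y k ∈ B}.encard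

/-- `Y` lists the (infinitely many) points of a Poisson process with intensity measure `Λ`:
the number of points in a measurable set `B` is Poisson distributed with mean `Λ B` (and is
a.s. infinite if `Λ B = ∞`), and the numbers of points in disjoint sets are independent. -/
structure IsPoissonProcess {Ω E : Type*} [MeasurableSpace Ω] [MeasurableSpace E]
    (Y : ℕ → Ω → E) (Λ : Measure E) (P : Measure Ω) : Prop where
  measurable : ∀ k, Measurable (Y k)
  map_count : ∀ B : Set E, MeasurableSet B → Λ B < ∞ →
    P.map (fun ω => pointCount (fun k => Y k ω) B) =
      (poissonMeasure (Λ B).toNNReal).map (fun n : ℕ => (n : ℕ∞))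
  count_eq_top : ∀ B : Set E, MeasurableSet B → Λ B = ∞ →
    ∀ᵐ ω ∂P, pointCount (fun k => Y k ω) B = ⊤
  indep : ∀ (n : ℕ) (B : Fin n → Set E), (∀ i, MeasurableSet (B i)) →
    Pairwise (fun i j => Disjoint (B i) (B j)) →
    iIndepFun (fun (i : Fin n) (ω : Ω) => pointCount (fun k => Y k ω) (B i)) P

/-! ### The sieving scheme

Points are triplets `(t, x, f)` with arrival time `t ∈ [0, ∞)`, position `x` and mark `f ∈ 𝒢`. -/

/-- The Lebesgue measure on the half-line `[0, ∞)`, as a measure on `ℝ`. -/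
def lebHalfLine : Measure ℝ := volume.restrict (Set.Ici 0)

instance : SigmaFinite lebHalfLine := inferInstanceAs (SigmaFinite (volume.restrict (Set.Ici 0)))

/-- `l` lists the elements of `S` in the order of increasing time. -/
structure IsTimeOrdered {X : Type*} (S : Set (ℝ × X × LipFun))
    (l : List (ℝ × X × LipFun)) : Prop where
  mem_iff : ∀ q, q ∈ l ↔ q ∈ S
  increasing : l.Pairwise fun q r => q.1 < r.1

open Classical in
/-- The composition of the marks of the points in `S` in the order of increasing time (earliest
point outermost), evaluated at `z₀`. (If `S` is infinite or has two points with the same time,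
the value is `z₀`; for the sets used below this has probability zero.) -/
def composeMarks {X : Type*} (S : Set (ℝ × X × LipFun)) (z₀ : ℝ) : ℝ :=
  if h : ∃ l, IsTimeOrdered S l then composeAt (h.choose.map fun q => q.2.2) z₀ else z₀

/-- The sieved backward iteration `ζ_t(A)`: the marks of the points of `Y` in `[0, t] × A × 𝒢`
composed in the order of their times and applied to `z₀`. -/
def sievedIter {X : Type*} (Y : ℕ → ℝ × X × LipFun) (z₀ : ℝ) (A : Set X) (t : ℝ) : ℝ :=
  composeMarks {q | q ∈ Set.range Y ∧ q.1 ∈ Set.Icc 0 t ∧ q.2.1 ∈ A} z₀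

/-- `ζ(A) = lim_{t → ∞} ζ_t(A)`. -/
def sievedLimit {X : Type*} (Y : ℕ → ℝ × X × LipFun) (z₀ : ℝ) (A : Set X) : ℝ :=
  limUnder atTop (sievedIter Y z₀ A)

/-- `ζ(x) = ζ([0, x])` for points with positions in the half-line. -/
def zetaProcess (Y : ℕ → ℝ × ℝ × LipFun) (z₀ : ℝ) (x : ℝ) : ℝ :=
  sievedLimit Y z₀ (Set.Icc 0 x)

/-! ### `p`-variation -/

/-- The `p`-variation `V_p(g; [a, b])`, the supremum over `a ≤ u₀ ≤ u₁ ≤ ⋯ ≤ uₙ ≤ b` of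
`∑ i, |g(u_{i+1}) - g(u_i)| ^ p`. -/
def pVariation (p : ℝ) (g : ℝ → ℝ) (a b : ℝ) : ℝ≥0∞ :=
  ⨆ q : ℕ × {u : ℕ → ℝ // Monotone u ∧ ∀ i, u i ∈ Set.Icc a b},
    ∑ i ∈ Finset.range q.1, ENNReal.ofReal (|g (q.2.1 (i + 1)) - g (q.2.1 i)| ^ p)

end

/-! Fix a width `X` and list the points with position in `[0, X]` by increasing time. Their marks
(position, function) form an i.i.d. sequence with law `Unif[0, X] ⊗ ν`
(`IsPoissonProcess.map_rankMark`). For every `x ≤ X`, `ζ(x)` is the backward limit of this one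
sequence when each function at a position beyond `x` is replaced by the identity
(`exists_sievedIter_eq`). The Poisson process thus reduces to random iteration driven by a single
i.i.d. sequence, simultaneously for all `x ≤ X`.

Convergence: on a short interval `[a, b]` with `b Φ(p) < a`, the maps for all `x ∈ [a, b]` share a
random Lipschitz constant whose `p`-th moment is below `1`. As `p ≤ 1`, powers are subadditive, so
the increments of the iterations are dominated by a series whose sum has a finite `p`-th moment. The
limits therefore exist uniformly on `[a, b]`, which also makes `ζ` right-continuous.

Increments: let `u ≤ v`, take the strip of width `v` and condition on the first mark `(ξ, f)`. If `ξ
≤ u`, which has probability `u/v`, both values pass through `f`. Otherwise `ζ(v) = f(ζ'(v))` and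
`ζ(u) = ζ'(u)`, with `ζ'` the process of the remaining marks, and both have the law of `Z_∞`. Hence
`e = E|ζ(v) - ζ(u)|^p` satisfies `e ≤ (u/v) Φ(p) e + (1 - u/v) 2 E|Z_∞|^p`, and so `e ≤ (1 - u/v) 2
E|Z_∞|^p / (1 - Φ(p))` (`lintegral_increment_le`).

Variation: for `p ≤ 1` refining a partition increases the sum, so by right-continuity `V_p` is the
liminf of the variations along uniform grids (`pVariation_eq_liminf`). This gives measurability.
Along a grid, `∑ (1 - uᵢ/uᵢ₊₁) ≤ log(b/a)`, and Fatou's lemma gives the bound. -/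

noncomputable section

/-! ### Points ranked by time -/

section Rank

variable {E : Type*}

/-- The number of points of `y` in `[0, ∞) × S` that precede the `k`-th one in time. -/
def timeRank (y : ℕ → ℝ × E) (S : Set E) (k : ℕ) : ℕ∞ :=
  {l | y l ∈ Set.Ici (0 : ℝ) ×ˢ S ∧ (y l).1 < (y k).1}.encard

/-- The `k`-th point of `y` lies in `[0, ∞) × S` and exactly `n` of the points there precede it. -/
def HasRank (y : ℕ → ℝ × E) (S : Set E) (k n : ℕ) : Prop :=
  y k ∈ Set.Ici (0 : ℝ) ×ˢ S ∧ timeRank y S k = n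

open Classical in
/-- An index of a point with rank `n` (zero if there is none). -/
def rankIndex (y : ℕ → ℝ × E) (S : Set E) (n : ℕ) : ℕ :=
  if h : ∃ k, HasRank y S k n then Nat.find h else 0

/-- The mark of the point with rank `n`. -/
def rankMark (y : ℕ → ℝ × E) (S : Set E) (n : ℕ) : E := (y (rankIndex y S n)).2

theorem hasRank_rankIndex {y : ℕ → ℝ × E} {S : Set E} {n : ℕ} (h : ∃ k, HasRank y S k n) :
    HasRank y S (rankIndex y S n) n := by
  classical
  rw [rankIndex, dif_pos h]
  exact Nat.find_spec h

/-- The time sets `J i` are ordered and the rest of `[0, T) × S` is empty, so the single points of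
the boxes are the first `n` points of the strip, in the order of `i`. -/
theorem exists_hasRank_iff_of_pattern {y : ℕ → ℝ × E} {S : Set E} {n : ℕ} {J : Fin n → Set ℝ}
    {A : Fin n → Set E} {T : ℝ} (hA : ∀ i, A i ⊆ S) (hJ : ∀ i, J i ⊆ Set.Ico 0 T)
    (hlt : ∀ i j, i < j → ∀ s ∈ J i, ∀ t ∈ J j, s < t)
    (h1 : ∀ i, pointCount y (J i ×ˢ A i) = 1)
    (h0 : pointCount y ((Set.Ico 0 T ×ˢ S) \ ⋃ i, J i ×ˢ A i) = 0) (i : Fin n) :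
    ∃ k, y k ∈ J i ×ˢ A i ∧ ∀ k', HasRank y S k' i ↔ k' = k := by
  have h1' : ∀ i, ∃ k, {l | y l ∈ J i ×ˢ A i} = {k} := fun i => Set.encard_eq_one.1 (h1 i)
  choose k hk using h1'
  have hmem : ∀ i, y (k i) ∈ J i ×ˢ A i := fun i => by
    have : k i ∈ {l | y l ∈ J i ×ˢ A i} := by rw [hk i]; rfl
    exact this
  have hkS : ∀ i, y (k i) ∈ Set.Ici (0 : ℝ) ×ˢ S := fun i =>
    ⟨(hJ i (hmem i).1).1, hA i (hmem i).2⟩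
  have hkt : ∀ i j, i < j → (y (k i)).1 < (y (k j)).1 := fun i j hij =>
    hlt i j hij _ (hmem i).1 _ (hmem j).1
  have hkinj : Function.Injective k := by
    intro i j hij
    by_contra hne
    rcases lt_or_gt_of_ne hne with h | h
    · exact absurd (hkt _ _ h) (by rw [hij]; exact lt_irrefl _)
    · exact absurd (hkt _ _ h) (by rw [hij]; exact lt_irrefl _)
  have h0' : {l | y l ∈ (Set.Ico 0 T ×ˢ S) \ ⋃ i, J i ×ˢ A i} = ∅ := Set.encard_eq_zero.1 h0
  have hall : ∀ l, y l ∈ Set.Ici (0 : ℝ) ×ˢ S → (∃ i, l = k i) ∨ T ≤ (y l).1 := by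
    intro l hl
    by_contra! hcon
    have : l ∈ {l | y l ∈ (Set.Ico 0 T ×ˢ S) \ ⋃ i, J i ×ˢ A i} := by
      refine ⟨⟨⟨hl.1, hcon.2⟩, hl.2⟩, ?_⟩
      intro hU
      obtain ⟨i, hi⟩ := Set.mem_iUnion.1 hU
      have : l ∈ {l | y l ∈ J i ×ˢ A i} := hi
      rw [hk i] at this
      exact hcon.1 i this
    rw [h0'] at this
    exact this
  have hkT : ∀ i, (y (k i)).1 < T := fun i => (hJ i (hmem i).1).2
  have hrank : ∀ i : Fin n, timeRank y S (k i) = (i : ℕ) := by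
    intro i
    have : {l | y l ∈ Set.Ici (0 : ℝ) ×ˢ S ∧ (y l).1 < (y (k i)).1} = k '' Set.Iio i := by
      ext l
      constructor
      · rintro ⟨hl, hlt'⟩
        rcases hall l hl with ⟨j, rfl⟩ | h
        · refine ⟨j, ?_, rfl⟩
          by_contra hj
          rcases eq_or_lt_of_le (not_lt.1 (Set.mem_Iio.not.1 hj)) with h | h
          · subst h; exact lt_irrefl _ hlt'
          · exact lt_asymm hlt' (hkt _ _ h)
        · exact absurd (hkT i) (not_lt.2 (h.trans hlt'.le))
      · rintro ⟨j, hj, rfl⟩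
        exact ⟨hkS j, hkt _ _ hj⟩
    rw [timeRank, this, hkinj.encard_image, Set.encard_eq_coe_toFinset_card]
    simp
  refine ⟨k i, hmem i, fun k' => ⟨fun h => ?_, ?_⟩⟩
  · rcases hall k' h.1 with ⟨j, rfl⟩ | hT
    · have := h.2
      rw [hrank j] at this
      congr 1
      exact Fin.ext (by exact_mod_cast this)
    -- A strip point at time `T` or later has all `n` box points before it, so its rank is at least
    -- `n > i`.
    · exfalso
      have hsub : Set.range k ⊆ {l | y l ∈ Set.Ici (0 : ℝ) ×ˢ S ∧ (y l).1 < (y k').1} := by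
        rintro _ ⟨j, rfl⟩
        exact ⟨hkS j, (hkT j).trans_le hT⟩
      have hle := Set.encard_le_encard hsub
      rw [← Set.image_univ, hkinj.encard_image, Set.encard_univ] at hle
      have h2 : timeRank y S k' = (i : ℕ) := h.2
      rw [timeRank] at h2
      rw [h2] at hle
      simp at hle
      exact absurd i.2 (not_lt.2 hle)
  · rintro rfl
    exact ⟨hkS i, hrank i⟩

end Rank

/-! ### Measurability of counts, ranks and ranked marks -/

section Measurability

variable {Ω E : Type*} [MeasurableSpace Ω] [MeasurableSpace E]

theorem measurable_pointCount {Y : ℕ → Ω → E} (hY : ∀ k, Measurable (Y k)) {B : Set E}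
    (hB : MeasurableSet B) : Measurable fun ω => pointCount (fun k => Y k ω) B :=
  measurable_encard.comp (measurable_set_iff.2 fun k => measurableSet_setOfPred.1 (hY k hB))

theorem measurableSet_hasRank {Y : ℕ → Ω → ℝ × E} (hY : ∀ k, Measurable (Y k)) {S : Set E}
    (hS : MeasurableSet S) (k n : ℕ) : MeasurableSet {ω | HasRank (fun l => Y l ω) S k n} := by
  have hstrip : MeasurableSet (Set.Ici (0 : ℝ) ×ˢ S) := measurableSet_Ici.prod hS
  have h : Measurable fun ω => timeRank (fun l => Y l ω) S k := by
    refine measurable_encard.comp (measurable_set_iff.2 fun l => measurableSet_setOfPred.1 ?_)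
    exact (hY l hstrip).inter (measurableSet_lt (hY l).fst (hY k).fst)
  exact (hY k hstrip).inter (h (measurableSet_singleton (n : ℕ∞)))

theorem measurable_rankIndex {Y : ℕ → Ω → ℝ × E} (hY : ∀ k, Measurable (Y k)) {S : Set E}
    (hS : MeasurableSet S) (n : ℕ) : Measurable fun ω => rankIndex (fun l => Y l ω) S n := by
  classical
  have hr := fun k => measurableSet_hasRank hY hS k n
  have hex : MeasurableSet {ω | ∃ k, HasRank (fun l => Y l ω) S k n} := by
    rw [Set.ofPred_exists]
    exact MeasurableSet.iUnion hr
  refine measurable_to_countable' fun k => ?_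
  have : (fun ω => rankIndex (fun l => Y l ω) S n) ⁻¹' {k} =
      ({ω | HasRank (fun l => Y l ω) S k n} ∩ ⋂ j ∈ Set.Iio k, {ω | HasRank (fun l => Y l ω) S j n}ᶜ)
        ∪ ({ω | ∃ k, HasRank (fun l => Y l ω) S k n}ᶜ ∩ {_ω | k = 0}) := by
    ext ω
    simp only [Set.mem_preimage, Set.mem_singleton_iff, rankIndex]
    by_cases h : ∃ k, HasRank (fun l => Y l ω) S k n
    · rw [dif_pos h, Nat.find_eq_iff]
      simp [h]
    · rw [dif_neg h]
      have h' : ∀ k, ¬ HasRank (fun l => Y l ω) S k n := fun k hk => h ⟨k, hk⟩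
      simp [h', eq_comm]
  rw [this]
  refine ((hr k).inter (MeasurableSet.biInter (Set.to_countable _) fun j _ => (hr j).compl)).union
    (hex.compl.inter (MeasurableSet.const _))

theorem measurable_rankMark {Y : ℕ → Ω → ℝ × E} (hY : ∀ k, Measurable (Y k)) {S : Set E}
    (hS : MeasurableSet S) (n : ℕ) : Measurable fun ω => rankMark (fun l => Y l ω) S n := by
  have h1 : Measurable fun q : ℕ × Ω => Y q.1 q.2 := measurable_from_prod_countable_right hY
  exact (h1.comp ((measurable_rankIndex hY hS n).prodMk measurable_id)).snd

end Measurability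

/-! ### Probabilities of count patterns -/

section Poisson

variable {Ω E : Type*} [MeasurableSpace Ω] [MeasurableSpace E] {P : Measure Ω}

theorem IsPoissonProcess.measure_count_eq {Y : ℕ → Ω → E} {Λ : Measure E}
    (hY : IsPoissonProcess Y Λ P) {B : Set E} (hB : MeasurableSet B) (hfin : Λ B < ∞) (n : ℕ) :
    P {ω | pointCount (fun k => Y k ω) B = n} =
      ENNReal.ofReal (Real.exp (-(Λ B).toReal) * (Λ B).toReal ^ n / n.factorial) := by
  have h := congrArg (fun μ => μ {(n : ℕ∞)}) (hY.map_count B hB hfin)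
  rw [Measure.map_apply (measurable_pointCount hY.measurable hB) (measurableSet_singleton _),
    Measure.map_apply (measurable_of_countable _) (measurableSet_singleton _)] at h
  have h2 : (fun n : ℕ => (n : ℕ∞)) ⁻¹' {(n : ℕ∞)} = {n} := by
    ext m; simp
  rw [h2, poissonMeasure_singleton] at h
  exact h

/-- Independence gives a product of `e^{-Λ(R)}` and `e^{-Λ(B i)} Λ(B i)`. The exponentials merge
into one that depends only on the total mass of the region, whatever the boxes are. -/
theorem IsPoissonProcess.measure_pattern {Y : ℕ → Ω → E} {Λ : Measure E}
    (hY : IsPoissonProcess Y Λ P) {n : ℕ} {B : Fin n → Set E} {R : Set E}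
    (hB : ∀ i, MeasurableSet (B i)) (hR : MeasurableSet R)
    (hd : Pairwise fun i j => Disjoint (B i) (B j)) (hdR : ∀ i, Disjoint R (B i))
    (hfin : ∀ i, Λ (B i) < ∞) (hRfin : Λ R < ∞) :
    P {ω | (∀ i, pointCount (fun k => Y k ω) (B i) = 1) ∧ pointCount (fun k => Y k ω) R = 0} =
      ENNReal.ofReal (Real.exp (-(Λ (R ∪ ⋃ i, B i)).toReal)) * ∏ i, Λ (B i) := by
  classical
  have hind := hY.indep (n + 1) (Fin.cons R B) (Fin.cases hR hB) (by
    intro i j hij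
    induction i using Fin.cases with
    | zero =>
      induction j using Fin.cases with
      | zero => exact absurd rfl hij
      | succ j => exact hdR j
    | succ i =>
      induction j using Fin.cases with
      | zero => exact (hdR i).symm
      | succ j => exact hd fun h => hij (congrArg _ h))
  have hm := hind.measure_inter_preimage_eq_mul (S := Finset.univ)
    (sets := Fin.cons {(0 : ℕ∞)} fun _ => {(1 : ℕ∞)})
    (fun i _ => by
      induction i using Fin.cases with
      | zero => exact measurableSet_singleton _
      | succ i => exact measurableSet_singleton _)
  have hset : {ω | (∀ i, pointCount (fun k => Y k ω) (B i) = 1) ∧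
      pointCount (fun k => Y k ω) R = 0} =
      ⋂ i ∈ (Finset.univ : Finset (Fin (n + 1))),
        (fun ω => pointCount (fun k => Y k ω) ((Fin.cons R B : Fin (n + 1) → Set E) i)) ⁻¹'
        (Fin.cons {(0 : ℕ∞)} (fun _ => {(1 : ℕ∞)}) : Fin (n + 1) → Set ℕ∞) i := by
    ext ω
    simp [Fin.forall_fin_succ, and_comm]
  rw [hset, hm, Fin.prod_univ_succ]
  simp only [Fin.cons_zero, Fin.cons_succ]
  have e0 : P ((fun ω => pointCount (fun k => Y k ω) R) ⁻¹' {0}) =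
      ENNReal.ofReal (Real.exp (-(Λ R).toReal)) := by
    have := hY.measure_count_eq hR hRfin 0
    simp only [Nat.cast_zero, pow_zero, mul_one, Nat.factorial_zero, Nat.cast_one, div_one] at this
    exact this
  have e1 : ∀ i, P ((fun ω => pointCount (fun k => Y k ω) (B i)) ⁻¹' {1}) =
      ENNReal.ofReal (Real.exp (-(Λ (B i)).toReal)) * Λ (B i) := by
    intro i
    have := hY.measure_count_eq (hB i) (hfin i) 1
    simp only [Nat.cast_one, pow_one, Nat.factorial_one, div_one] at this
    rw [ENNReal.ofReal_mul (Real.exp_nonneg _), ENNReal.ofReal_toReal (hfin i).ne] at this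
    exact this
  rw [e0, Finset.prod_congr rfl fun i _ => e1 i, Finset.prod_mul_distrib, ← mul_assoc]
  congr 1
  have hΛ : (Λ (R ∪ ⋃ i, B i)).toReal = (Λ R).toReal + ∑ i, (Λ (B i)).toReal := by
    rw [measure_union (Set.disjoint_iUnion_right.2 hdR) (MeasurableSet.iUnion hB),
      measure_iUnion hd hB, tsum_fintype, ENNReal.toReal_add hRfin.ne
        (ENNReal.sum_lt_top.2 fun i _ => hfin i).ne, ENNReal.toReal_sum fun i _ => (hfin i).ne]
  rw [hΛ, neg_add, Real.exp_add, ENNReal.ofReal_mul (Real.exp_nonneg _), ← Finset.sum_neg_distrib,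
    Real.exp_sum, ENNReal.ofReal_prod_of_nonneg fun i _ => Real.exp_nonneg _]

end Poisson

/-! ### Discretised time: slices encoded by the number of slices skipped between consecutive points
-/

section Gaps

variable {n : ℕ}

/-- The partial sums of `g l + 1`. -/
def gapSum (g : Fin n → ℕ) (i : ℕ) : ℕ := ∑ l : Fin n with l.val < i, (g l + 1)

theorem gapSum_succ (g : Fin n → ℕ) (i : Fin n) : gapSum g (i + 1) = gapSum g i + g i + 1 := by
  classical
  have : (Finset.univ.filter fun l : Fin n => l.val < i + 1) =
      insert i (Finset.univ.filter fun l : Fin n => l.val < i) := by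
    ext l
    simp only [Finset.mem_filter, Finset.mem_univ, true_and, Finset.mem_insert, Fin.ext_iff]
    omega
  rw [gapSum, this, Finset.sum_insert (by simp), gapSum]
  ring

theorem gapSum_mono (g : Fin n → ℕ) : Monotone (gapSum g) := fun _ _ hij =>
  Finset.sum_le_sum_of_subset fun l hl => by
    simp only [Finset.mem_filter, Finset.mem_univ, true_and] at hl ⊢
    omega

theorem gapSum_self (g : Fin n → ℕ) : gapSum g n = ∑ l, (g l + 1) := by
  rw [gapSum, Finset.filter_true_of_mem fun l _ => l.2]

theorem gapSum_injective {g g' : Fin n → ℕ} (h : ∀ i : Fin n, gapSum g i + g i = gapSum g' i + g' i) :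
    g = g' := by
  have hs : ∀ i, i ≤ n → gapSum g i = gapSum g' i := by
    intro i hi
    induction i with
    | zero => simp [gapSum]
    | succ i _ =>
      have h1 := gapSum_succ g ⟨i, hi⟩
      have h2 := gapSum_succ g' ⟨i, hi⟩
      have h3 := h ⟨i, hi⟩
      simp only at h1 h2 h3
      omega
  funext i
  have h1 := hs i i.2.le
  have h2 := h i
  omega

/-- The time slice of length `h` that is preceded by `gapSum g i + g i` slices. -/
def gapSlice (h : ℝ) (g : Fin n → ℕ) (i : Fin n) : Set ℝ :=
  Set.Ico (h * (gapSum g i + g i : ℕ)) (h * (gapSum g i + g i + 1 : ℕ))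

theorem gapSlice_subset {h : ℝ} (hh : 0 < h) (g : Fin n → ℕ) (i : Fin n) :
    gapSlice h g i ⊆ Set.Ico 0 (h * gapSum g n) := by
  refine Set.Ico_subset_Ico (by positivity) (mul_le_mul_of_nonneg_left ?_ hh.le)
  rw [← gapSum_succ]
  exact_mod_cast gapSum_mono g i.2

theorem lt_of_mem_gapSlice {h : ℝ} (hh : 0 < h) (g : Fin n → ℕ) {i j : Fin n} (hij : i < j)
    {s t : ℝ} (hs : s ∈ gapSlice h g i) (ht : t ∈ gapSlice h g j) : s < t := by
  refine hs.2.trans_le (le_trans (mul_le_mul_of_nonneg_left ?_ hh.le) ht.1)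
  rw [← gapSum_succ]
  exact_mod_cast (gapSum_mono g (show (i : ℕ) + 1 ≤ j from hij)).trans (Nat.le_add_right _ _)

/-- All slices belong to one grid of mesh `h`, so slices that meet coincide, and the slice numbers
determine the gaps. This makes the events for different gap vectors disjoint. -/
theorem eq_of_mem_gapSlice {h : ℝ} (hh : 0 < h) {g g' : Fin n → ℕ}
    (hg : ∀ i, ∃ t, t ∈ gapSlice h g i ∧ t ∈ gapSlice h g' i) : g = g' := by
  refine gapSum_injective fun i => ?_
  obtain ⟨t, h1, h2⟩ := hg i
  have h3 := lt_of_mul_lt_mul_left (h1.1.trans_lt h2.2) hh.le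
  have h4 := lt_of_mul_lt_mul_left (h2.1.trans_lt h1.2) hh.le
  have h5 := Nat.cast_lt.1 h3
  have h6 := Nat.cast_lt.1 h4
  omega

theorem volume_gapSlice (h : ℝ) (g : Fin n → ℕ) (i : Fin n) :
    volume (gapSlice h g i) = ENNReal.ofReal h := by
  rw [gapSlice, Real.volume_Ico]
  congr 1
  push_cast
  ring

theorem measurableSet_gapSlice (h : ℝ) (g : Fin n → ℕ) (i : Fin n) :
    MeasurableSet (gapSlice h g i) := measurableSet_Ico

theorem lebHalfLine_apply_of_subset {J : Set ℝ} (hJ : J ⊆ Set.Ici 0) :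
    lebHalfLine J = volume J := Measure.restrict_eq_self _ hJ

end Gaps

/-! ### The marks of the first `n` points -/

section Enumeration

variable {Ω E : Type*} [MeasurableSpace Ω] [MeasurableSpace E] {P : Measure Ω}
  {Y : ℕ → Ω → ℝ × E} {ρ : Measure E} [SigmaFinite ρ]

/-- For every `i < n` there is exactly one point of rank `i`, and its mark lies in `A i`. -/
def markEvent (Y : ℕ → Ω → ℝ × E) (S : Set E) {n : ℕ} (A : Fin n → Set E) : Set Ω :=
  {ω | ∀ i : Fin n, (∃! k, HasRank (fun l => Y l ω) S k i) ∧ rankMark (fun l => Y l ω) S i ∈ A i}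

/-- For each gap vector `g`, consider the event of exactly one point in each `gapSlice h g i × A i`
and no other point of the strip before time `h * gapSum g n`. These disjoint events lie in
`markEvent`, and their probabilities factorise over `i` because `gapSum g n = ∑ (g i + 1)`. Only a
lower bound results, since the gaps are truncated at `M` and points sharing a slice are missed. -/
theorem prod_le_measure_markEvent (hY : IsPoissonProcess Y (lebHalfLine.prod ρ) P)
    {S : Set E} (hS : MeasurableSet S) (hSfin : ρ S < ∞) {n : ℕ} {A : Fin n → Set E}
    (hA : ∀ i, MeasurableSet (A i)) (hAS : ∀ i, A i ⊆ S) {h : ℝ} (hh : 0 < h) (M : ℕ) :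
    ∏ i, ∑ j ∈ Finset.range M,
      ENNReal.ofReal (Real.exp (-(h * (ρ S).toReal * (j + 1)))) * (ENNReal.ofReal h * ρ (A i)) ≤
      P (markEvent Y S A) := by
  classical
  set Ev : (Fin n → ℕ) → Set Ω := fun g =>
    {ω | (∀ i, pointCount (fun k => Y k ω) (gapSlice h g i ×ˢ A i) = 1) ∧
      pointCount (fun k => Y k ω)
        ((Set.Ico 0 (h * gapSum g n) ×ˢ S) \ ⋃ i, gapSlice h g i ×ˢ A i) = 0} with hEv
  have hsub0 : ∀ g : Fin n → ℕ, ∀ i, gapSlice h g i ⊆ Set.Ici 0 := fun g i =>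
    (gapSlice_subset hh g i).trans Set.Ico_subset_Ici_self
  have hmB : ∀ g : Fin n → ℕ, ∀ i, MeasurableSet (gapSlice h g i ×ˢ A i) := fun g i =>
    (measurableSet_gapSlice h g i).prod (hA i)
  have hmR : ∀ g : Fin n → ℕ, MeasurableSet
      ((Set.Ico 0 (h * gapSum g n) ×ˢ S) \ ⋃ i, gapSlice h g i ×ˢ A i) := fun g =>
    (measurableSet_Ico.prod hS).diff (MeasurableSet.iUnion (hmB g))
  have hpat : ∀ g : Fin n → ℕ, ∀ ω ∈ Ev g, ∀ i : Fin n, ∃ k, Y k ω ∈ gapSlice h g i ×ˢ A i ∧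
      ∀ k', HasRank (fun l => Y l ω) S k' i ↔ k' = k := fun g ω hω =>
    exists_hasRank_iff_of_pattern hAS (gapSlice_subset hh g)
      (fun i j hij s hs t ht => lt_of_mem_gapSlice hh g hij hs ht) hω.1 hω.2
  have hEvm : ∀ g, MeasurableSet (Ev g) := by
    intro g
    refine MeasurableSet.inter ?_ ?_
    · have : {ω | ∀ i, pointCount (fun k => Y k ω) (gapSlice h g i ×ˢ A i) = 1} =
          ⋂ i, {ω | pointCount (fun k => Y k ω) (gapSlice h g i ×ˢ A i) = 1} := by
        ext; simp
      change MeasurableSet {ω | ∀ i, pointCount (fun k => Y k ω) (gapSlice h g i ×ˢ A i) = 1}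
      rw [this]
      exact MeasurableSet.iInter fun i =>
        measurable_pointCount hY.measurable (hmB g i) (measurableSet_singleton 1)
    · exact measurable_pointCount hY.measurable (hmR g) (measurableSet_singleton 0)
  have hEvP : ∀ g, P (Ev g) = ∏ i, ENNReal.ofReal (Real.exp (-(h * (ρ S).toReal * (g i + 1)))) *
      (ENNReal.ofReal h * ρ (A i)) := by
    intro g
    have hΛ : ∀ i, (lebHalfLine.prod ρ) (gapSlice h g i ×ˢ A i) = ENNReal.ofReal h * ρ (A i) := by
      intro i
      rw [Measure.prod_prod, lebHalfLine_apply_of_subset (hsub0 g i), volume_gapSlice]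
    have hsub : ⋃ i, gapSlice h g i ×ˢ A i ⊆ Set.Ico 0 (h * gapSum g n) ×ˢ S :=
      Set.iUnion_subset fun i => Set.prod_mono (gapSlice_subset hh g i) (hAS i)
    have hT : (lebHalfLine.prod ρ) (Set.Ico 0 (h * gapSum g n) ×ˢ S) =
        ENNReal.ofReal (h * gapSum g n) * ρ S := by
      rw [Measure.prod_prod, lebHalfLine_apply_of_subset Set.Ico_subset_Ici_self, Real.volume_Ico,
        sub_zero]
    have hTfin : (lebHalfLine.prod ρ) (Set.Ico 0 (h * gapSum g n) ×ˢ S) < ∞ := by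
      rw [hT]
      exact ENNReal.mul_lt_top ENNReal.ofReal_lt_top hSfin
    rw [hEv, hY.measure_pattern (hmB g) (hmR g) ?_ ?_ ?_ ?_]
    · rw [Set.sdiff_union_of_subset hsub, hT, ENNReal.toReal_mul,
        ENNReal.toReal_ofReal (by positivity), Finset.prod_congr rfl fun i _ => hΛ i]
      conv_rhs => rw [Finset.prod_mul_distrib]
      congr 1
      rw [← ENNReal.ofReal_prod_of_nonneg fun i _ => Real.exp_nonneg _, ← Real.exp_sum,
        gapSum_self]
      congr 2
      push_cast
      rw [Finset.sum_neg_distrib, ← Finset.mul_sum]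
      ring
    · intro i j hij
      refine Set.disjoint_left.2 fun q hq hq' => ?_
      rcases lt_or_gt_of_ne hij with h1 | h1
      · exact lt_irrefl _ (lt_of_mem_gapSlice hh g h1 hq.1 hq'.1)
      · exact lt_irrefl _ (lt_of_mem_gapSlice hh g h1 hq'.1 hq.1)
    · intro i
      exact Set.disjoint_sdiff_left.mono_right (Set.subset_iUnion (fun i => gapSlice h g i ×ˢ A i) i)
    · intro i
      exact (measure_mono ((Set.subset_iUnion (fun i => gapSlice h g i ×ˢ A i) i).trans hsub)).trans_lt
        hTfin
    · exact (measure_mono Set.sdiff_subset).trans_lt hTfin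
  have hdisj : (↑(Fintype.piFinset fun _ : Fin n => Finset.range M) : Set (Fin n → ℕ)).PairwiseDisjoint
      Ev := by
    intro g _ g' _ hne
    refine Set.disjoint_left.2 fun ω h1 h2 => hne ?_
    refine eq_of_mem_gapSlice hh fun i => ?_
    obtain ⟨k, hk, hk'⟩ := hpat g ω h1 i
    obtain ⟨l, hl, hl'⟩ := hpat g' ω h2 i
    have : l = k := (hk' l).1 ((hl' l).2 rfl)
    subst this
    exact ⟨_, hk.1, hl.1⟩
  -- The product of sums expands into a sum over gap vectors in the box `{0, …, M - 1}^n`, one term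
  -- per event.
  rw [Finset.prod_univ_sum]
  calc _ = ∑ g ∈ Fintype.piFinset fun _ : Fin n => Finset.range M, P (Ev g) :=
        Finset.sum_congr rfl fun g _ => (hEvP g).symm
    _ = P (⋃ g ∈ Fintype.piFinset fun _ : Fin n => Finset.range M, Ev g) :=
        (measure_biUnion_finset hdisj fun g _ => hEvm g).symm
    _ ≤ P (markEvent Y S A) := by
        refine measure_mono (Set.iUnion₂_subset fun g _ ω hω i => ?_)
        obtain ⟨k, hk, hk'⟩ := hpat g ω hω i
        refine ⟨⟨k, (hk' k).2 rfl, fun k' h => (hk' k').1 h⟩, ?_⟩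
        have : rankIndex (fun l => Y l ω) S i = k :=
          (hk' _).1 (hasRank_rankIndex ⟨k, (hk' k).2 rfl⟩)
        rw [rankMark, this]
        exact hk.2

/-- The right side is the right-endpoint Riemann sum, with mesh `1 / (m + 1)`, of `∫ e^{-t}` over
`[0, m + 1]`. It is geometric, and `1 - e^{-l} ≤ l` gives a lower bound that tends to `1`. -/
theorem le_sum_exp (m : ℕ) :
    Real.exp (-(1 / (m + 1 : ℝ))) * (1 - Real.exp (-(m + 1 : ℝ))) ≤
      ∑ j ∈ Finset.range ((m + 1) ^ 2), 1 / (m + 1 : ℝ) * Real.exp (-(1 / (m + 1 : ℝ) * (j + 1))) := by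
  set l : ℝ := 1 / (m + 1 : ℝ) with hl
  have hl0 : 0 < l := by positivity
  have hx1 : Real.exp (-l) < 1 := (Real.exp_lt_one_iff).2 (by linarith)
  have hterm : ∀ j : ℕ, l * Real.exp (-(l * (j + 1))) = l * Real.exp (-l) * Real.exp (-l) ^ j := by
    intro j
    rw [← Real.exp_nat_mul, mul_assoc, ← Real.exp_add]
    congr 2
    ring
  rw [Finset.sum_congr rfl fun j _ => hterm j, ← Finset.mul_sum, geom_sum_eq hx1.ne,
    ← Real.exp_nat_mul]
  have h1 : ((((m + 1) ^ 2 : ℕ) : ℝ)) * -l = -(m + 1 : ℝ) := by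
    rw [hl]; push_cast; field_simp
  rw [h1]
  have h2 : 1 - Real.exp (-l) ≤ l := by linarith [Real.add_one_le_exp (-l)]
  have h3 : Real.exp (-(m + 1 : ℝ)) ≤ 1 := ((Real.exp_lt_one_iff).2 (by linarith)).le
  have h4 : (Real.exp (-(m + 1 : ℝ)) - 1) / (Real.exp (-l) - 1) =
      (1 - Real.exp (-(m + 1 : ℝ))) / (1 - Real.exp (-l)) := by
    rw [← neg_sub, ← neg_sub (1 : ℝ) (Real.exp (-l)), neg_div_neg_eq]
  rw [h4, mul_comm l, mul_assoc]
  refine mul_le_mul_of_nonneg_left ?_ (Real.exp_nonneg _)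
  rw [mul_div_assoc', le_div_iff₀ (by linarith)]
  nlinarith

theorem prod_cond_le_measure_markEvent (hY : IsPoissonProcess Y (lebHalfLine.prod ρ) P)
    {S : Set E} (hS : MeasurableSet S) (hS0 : ρ S ≠ 0) (hSfin : ρ S < ∞) {n : ℕ}
    {A : Fin n → Set E} (hA : ∀ i, MeasurableSet (A i)) :
    ∏ i, ρ[A i | S] ≤ P (markEvent Y S A) := by
  have hc : 0 < (ρ S).toReal := ENNReal.toReal_pos hS0 hSfin.ne
  have key : ∀ m : ℕ, ENNReal.ofReal (Real.exp (-(1 / (m + 1 : ℝ))) *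
      (1 - Real.exp (-(m + 1 : ℝ)))) ^ n * ∏ i, ρ[A i | S] ≤ P (markEvent Y S A) := by
    intro m
    have h0 := prod_le_measure_markEvent hY hS hSfin (A := fun i => S ∩ A i)
      (fun i => hS.inter (hA i)) (fun i => Set.inter_subset_left)
      -- With this slice length each slice of the strip has mass `1 / (m + 1)`, the mesh in
      -- `le_sum_exp`.
      (h := 1 / (m + 1 : ℝ) / (ρ S).toReal) (by positivity) ((m + 1) ^ 2)
    have h1 : P (markEvent Y S fun i => S ∩ A i) ≤ P (markEvent Y S A) :=
      measure_mono fun ω hω i => ⟨(hω i).1, (hω i).2.2⟩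
    refine le_trans ?_ (h0.trans h1)
    have h2 : ENNReal.ofReal (Real.exp (-(1 / (m + 1 : ℝ))) * (1 - Real.exp (-(m + 1 : ℝ)))) ^ n =
        ∏ _i : Fin n,
          ENNReal.ofReal (Real.exp (-(1 / (m + 1 : ℝ))) * (1 - Real.exp (-(m + 1 : ℝ)))) := by
      simp
    rw [h2, ← Finset.prod_mul_distrib]
    refine Finset.prod_le_prod' fun i _ => ?_
    calc _ ≤ ENNReal.ofReal (∑ j ∈ Finset.range ((m + 1) ^ 2),
          1 / (m + 1 : ℝ) * Real.exp (-(1 / (m + 1 : ℝ) * (j + 1)))) * ρ[A i | S] := by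
          gcongr
          exact le_sum_exp m
      _ = _ := by
          rw [ENNReal.ofReal_sum_of_nonneg fun j _ => by positivity, Finset.sum_mul]
          refine Finset.sum_congr rfl fun j _ => ?_
          rw [cond_apply hS, div_mul_cancel₀ _ hc.ne',
            ENNReal.ofReal_mul (by positivity), ENNReal.ofReal_div_of_pos hc,
            ENNReal.ofReal_toReal hSfin.ne, ENNReal.div_eq_inv_mul]
          ring
  have hlim : Tendsto (fun m : ℕ => Real.exp (-(1 / (m + 1 : ℝ))) * (1 - Real.exp (-(m + 1 : ℝ))))
      atTop (𝓝 (Real.exp (-0) * (1 - 0))) := by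
    refine Tendsto.mul ?_ (tendsto_const_nhds.sub ?_)
    · exact (Real.continuous_exp.tendsto _).comp tendsto_one_div_add_atTop_nhds_zero_nat.neg
    · exact Real.tendsto_exp_neg_atTop_nhds_zero.comp
        (tendsto_atTop_add_const_right _ _ tendsto_natCast_atTop_atTop)
  have hlim2 := ENNReal.Tendsto.mul_const (b := ∏ i, ρ[A i | S])
    ((ENNReal.continuous_pow n).tendsto _ |>.comp (ENNReal.tendsto_ofReal hlim)) (Or.inl (by simp))
  simp only [neg_zero, Real.exp_zero, sub_zero, mul_one, ENNReal.ofReal_one, one_pow, one_mul]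
    at hlim2
  exact le_of_tendsto hlim2 (Eventually.of_forall key)

end Enumeration

/-- Lower bounds on cylinders suffice between probability measures: replacing one factor by its
complement splits a cylinder into two, both bounded below, and the two bounds already add up to the
mass of the cylinder. So neither can be strict. -/
theorem eq_infinitePi_of_prod_le {E : Type*} [MeasurableSpace E] {κ : Measure E}
    [IsProbabilityMeasure κ] {μ : Measure (ℕ → E)} [IsProbabilityMeasure μ]
    (h : ∀ (s : Finset ℕ) (t : ℕ → Set E), (∀ i, MeasurableSet (t i)) →
      ∏ i ∈ s, κ (t i) ≤ μ (Set.pi s t)) :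
    μ = Measure.infinitePi fun _ => κ := by
  classical
  refine Measure.eq_infinitePi _ fun s => ?_
  induction s using Finset.induction_on with
  | empty => intro t _; simp
  | insert i s his ih =>
    intro t ht
    refine le_antisymm ?_ (h _ t ht)
    set t' := Function.update t i (t i)ᶜ with ht'
    have htm' : ∀ j, MeasurableSet (t' j) := by
      intro j
      rcases eq_or_ne j i with rfl | hj
      · simp [ht', (ht j).compl]
      · simp [ht', hj, ht j]
    have hti : t' i = (t i)ᶜ := by simp [ht']
    have hts : ∀ j ∈ s, t' j = t j := fun j hj =>
      Function.update_of_ne (ne_of_mem_of_not_mem hj his) _ _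
    have hsplit : μ (Set.pi s t) = μ (Set.pi ↑(insert i s) t) + μ (Set.pi ↑(insert i s) t') := by
      rw [← measure_inter_add_sdiff (Set.pi s t) (measurable_pi_apply i (ht i))]
      congr 2
      · ext x
        simp [Set.mem_pi, and_comm]
      · ext x
        have : (∀ j ∈ s, x j ∈ t' j) ↔ ∀ j ∈ s, x j ∈ t j :=
          forall₂_congr fun j hj => by rw [hts j hj]
        simp only [Set.mem_sdiff, Set.mem_pi, Finset.mem_coe, Set.mem_preimage,
          Finset.forall_mem_insert, this, hti, Set.mem_compl_iff]
        exact and_comm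
    have h2 := h (insert i s) t' htm'
    rw [Finset.prod_insert his]
    rw [Finset.prod_insert his, Finset.prod_congr rfl fun j hj => congrArg κ (hts j hj)] at h2
    rw [hti] at h2
    have hsum : κ (t i) * ∏ j ∈ s, κ (t j) + κ (t i)ᶜ * ∏ j ∈ s, κ (t j) = ∏ j ∈ s, κ (t j) := by
      rw [← add_mul, prob_add_prob_compl (ht i), one_mul]
    have hfin : κ (t i)ᶜ * ∏ j ∈ s, κ (t j) ≠ ∞ :=
      (h2.trans_lt (measure_lt_top _ _)).ne
    refine (ENNReal.add_le_add_iff_right hfin).1 ?_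
    refine (add_le_add le_rfl h2).trans ?_
    rw [← hsplit, ih t ht, hsum]

/-! ### The ranked marks are i.i.d., and almost surely the ranks are well defined -/

section Law

variable {Ω E : Type*} [MeasurableSpace Ω] [MeasurableSpace E] {P : Measure Ω}
  {Y : ℕ → Ω → ℝ × E} {ρ : Measure E} [SigmaFinite ρ]

theorem IsPoissonProcess.map_rankMark [IsProbabilityMeasure P]
    (hY : IsPoissonProcess Y (lebHalfLine.prod ρ) P)
    {S : Set E} (hS : MeasurableSet S) (hS0 : ρ S ≠ 0) (hSfin : ρ S < ∞) :
    P.map (fun ω n => rankMark (fun l => Y l ω) S n) = Measure.infinitePi fun _ : ℕ => ρ[|S] := by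
  classical
  have hm : Measurable fun ω n => rankMark (fun l => Y l ω) S n :=
    measurable_pi_lambda _ fun n => measurable_rankMark hY.measurable hS n
  have : IsProbabilityMeasure (ρ[|S]) := cond_isProbabilityMeasure_of_finite hS0 hSfin.ne
  have := Measure.isProbabilityMeasure_map (μ := P) hm.aemeasurable
  refine eq_infinitePi_of_prod_le fun s t ht => ?_
  obtain ⟨n, hn⟩ := s.exists_nat_subset_range
  have h := prod_cond_le_measure_markEvent hY hS hS0 hSfin (n := n)
    -- Coordinates outside `s` are padded with the whole space, so that an initial segment of ranks
    -- is constrained.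
    (A := fun i => if (i : ℕ) ∈ s then t i else Set.univ)
    (fun i => by split_ifs; exacts [ht _, MeasurableSet.univ])
  rw [Measure.map_apply hm (MeasurableSet.pi s.countable_toSet fun i _ => ht i)]
  refine le_trans (le_of_eq ?_) (h.trans (measure_mono ?_))
  · rw [Fin.prod_univ_eq_prod_range (fun i => ρ[if i ∈ s then t i else Set.univ | S]) n,
      ← Finset.prod_subset hn fun i _ hi => by simp [hi]]
    exact Finset.prod_congr rfl fun i hi => by rw [if_pos hi]
  · intro ω hω i hi
    have := (hω ⟨i, Finset.mem_range.1 (hn hi)⟩).2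
    simp only [if_pos (show i ∈ s from hi)] at this
    exact this

theorem IsPoissonProcess.ae_existsUnique_hasRank [IsProbabilityMeasure P]
    (hY : IsPoissonProcess Y (lebHalfLine.prod ρ) P)
    {S : Set E} (hS : MeasurableSet S) (hS0 : ρ S ≠ 0) (hSfin : ρ S < ∞) :
    ∀ᵐ ω ∂P, ∀ n : ℕ, ∃! k, HasRank (fun l => Y l ω) S k n := by
  have : IsProbabilityMeasure (ρ[|S]) := cond_isProbabilityMeasure_of_finite hS0 hSfin.ne
  refine ae_all_iff.2 fun n => ?_
  -- With no constraint on the marks the lower bound is `1`, so the required ranks exist uniquely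
  -- almost surely.
  have h := prod_cond_le_measure_markEvent hY hS hS0 hSfin (n := n + 1) (A := fun _ => Set.univ)
    fun _ => MeasurableSet.univ
  simp only [measure_univ, Finset.prod_const_one] at h
  have hmeas : MeasurableSet (markEvent Y S fun _ : Fin (n + 1) => Set.univ) := by
    have : markEvent Y S (fun _ : Fin (n + 1) => Set.univ) = ⋂ i : Fin (n + 1), ⋃ k,
        ({ω | HasRank (fun l => Y l ω) S k i} ∩
          ⋂ j ∈ {j | j ≠ k}, {ω | HasRank (fun l => Y l ω) S j i}ᶜ) := by
      ext ω
      simp only [markEvent, ExistsUnique, Set.mem_univ, and_true, Set.mem_iInter, Set.mem_iUnion]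
      refine forall_congr' fun i => exists_congr fun k => and_congr Iff.rfl ?_
      simp only [Set.mem_iInter]
      exact ⟨fun h j hj hj' => hj (h j hj'), fun h j hj => by_contra fun hne => h j hne hj⟩
    rw [this]
    exact MeasurableSet.iInter fun i => MeasurableSet.iUnion fun k =>
      (measurableSet_hasRank hY.measurable hS k i).inter
        (MeasurableSet.biInter (Set.to_countable _) fun j _ =>
          (measurableSet_hasRank hY.measurable hS j i).compl)
  have h1 : P (markEvent Y S fun _ : Fin (n + 1) => Set.univ) = 1 := le_antisymm prob_le_one h
  have h2 := (prob_compl_eq_zero_iff hmeas).2 h1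
  filter_upwards [compl_mem_ae_iff.2 h2] with ω hω
  rw [compl_compl] at hω
  exact (hω (Fin.last n)).1

theorem IsPoissonProcess.ae_finite (hY : IsPoissonProcess Y (lebHalfLine.prod ρ) P)
    {S : Set E} (hS : MeasurableSet S) (hSfin : ρ S < ∞) :
    ∀ᵐ ω ∂P, ∀ T : ℕ, {k | Y k ω ∈ Set.Icc (0 : ℝ) T ×ˢ S}.Finite := by
  refine ae_all_iff.2 fun T => ?_
  have hB : MeasurableSet (Set.Icc (0 : ℝ) T ×ˢ S) := measurableSet_Icc.prod hS
  have hfin : (lebHalfLine.prod ρ) (Set.Icc (0 : ℝ) T ×ˢ S) < ∞ := by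
    rw [Measure.prod_prod, lebHalfLine_apply_of_subset Set.Icc_subset_Ici_self, Real.volume_Icc]
    exact ENNReal.mul_lt_top ENNReal.ofReal_lt_top hSfin
  have h := congrArg (fun μ => μ {(⊤ : ℕ∞)}) (hY.map_count _ hB hfin)
  rw [Measure.map_apply (measurable_pointCount hY.measurable hB) (measurableSet_singleton _),
    Measure.map_apply (measurable_of_countable _) (measurableSet_singleton _)] at h
  have h2 : (fun n : ℕ => (n : ℕ∞)) ⁻¹' {⊤} = ∅ := by
    ext m; simp
  rw [h2, measure_empty] at h
  filter_upwards [compl_mem_ae_iff.2 h] with ω hω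
  exact Set.encard_ne_top_iff.1 hω

end Law

/-! ### Backward iterations -/

/-- The composition `φ 0 ∘ φ 1 ∘ ⋯ ∘ φ (n - 1)` at `z`. -/
def backComp (φ : ℕ → ℝ → ℝ) (n : ℕ) (z : ℝ) : ℝ := (List.range n).foldr (fun i w => φ i w) z

theorem backComp_zero (φ : ℕ → ℝ → ℝ) (z : ℝ) : backComp φ 0 z = z := rfl

theorem backComp_succ (φ : ℕ → ℝ → ℝ) (n : ℕ) (z : ℝ) :
    backComp φ (n + 1) z = backComp φ n (φ n z) := by
  simp [backComp, List.range_succ]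

/-- Peeling off the outermost map serves the conditioning on the first mark; `backComp_succ`, which
peels off the innermost, serves the Cauchy estimate. -/
theorem backComp_succ' (φ : ℕ → ℝ → ℝ) (n : ℕ) (z : ℝ) :
    backComp φ (n + 1) z = φ 0 (backComp (fun i => φ (i + 1)) n z) := by
  simp [backComp, List.range_succ_eq_map, List.foldr_map]

theorem backwardIter_eq_backComp (f : ℕ → LipFun) (z₀ : ℝ) (n : ℕ) :
    backwardIter f z₀ n = backComp (fun i => f i) n z₀ := by
  simp [backwardIter, composeAt, backComp, List.foldr_map]

section Contraction

variable {φ : ℕ → ℝ → ℝ} {M D : ℕ → ℝ} {z₀ : ℝ}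

theorem abs_backComp_sub_le (hM0 : ∀ i, 0 ≤ M i)
    (hM : ∀ i x y, |φ i x - φ i y| ≤ M i * |x - y|) (n : ℕ) (x y : ℝ) :
    |backComp φ n x - backComp φ n y| ≤ (∏ i ∈ Finset.range n, M i) * |x - y| := by
  induction n generalizing x y with
  | zero => simp [backComp_zero]
  | succ n ih =>
    rw [backComp_succ, backComp_succ, Finset.prod_range_succ, mul_assoc]
    exact (ih _ _).trans (mul_le_mul_of_nonneg_left (hM n x y)
      (Finset.prod_nonneg fun i _ => hM0 i))

/-- The new map acts innermost, so its displacement of `z₀` is contracted by all earlier maps. This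
is why backward iterations converge pointwise. -/
theorem dist_backComp_succ_le (hM0 : ∀ i, 0 ≤ M i)
    (hM : ∀ i x y, |φ i x - φ i y| ≤ M i * |x - y|) (hD : ∀ i, |φ i z₀ - z₀| ≤ D i) (n : ℕ) :
    dist (backComp φ n z₀) (backComp φ (n + 1) z₀) ≤ (∏ i ∈ Finset.range n, M i) * D n := by
  rw [dist_comm, Real.dist_eq, backComp_succ]
  exact (abs_backComp_sub_le hM0 hM n _ _).trans
    (mul_le_mul_of_nonneg_left (hD n) (Finset.prod_nonneg fun i _ => hM0 i))

theorem exists_tendsto_backComp (hM0 : ∀ i, 0 ≤ M i)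
    (hM : ∀ i x y, |φ i x - φ i y| ≤ M i * |x - y|) (hD : ∀ i, |φ i z₀ - z₀| ≤ D i)
    (hs : Summable fun n => (∏ i ∈ Finset.range n, M i) * D n) :
    ∃ z, Tendsto (fun n => backComp φ n z₀) atTop (𝓝 z) ∧
      ∀ n, |backComp φ n z₀ - z| ≤ ∑' k, (∏ i ∈ Finset.range (n + k), M i) * D (n + k) := by
  have hd := dist_backComp_succ_le hM0 hM hD
  obtain ⟨z, hz⟩ := cauchySeq_tendsto_of_complete (cauchySeq_of_dist_le_of_summable _ hd hs)
  exact ⟨z, hz, fun n => dist_le_tsum_of_dist_le_of_tendsto _ hd hs hz n⟩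

end Contraction

/-! ### Sieving a sequence of marks -/

/-- The map that the mark `(ξ, g)` contributes when only positions up to `x` are kept. -/
def sieveMap (x : ℝ) (q : ℝ × LipFun) (z : ℝ) : ℝ := if q.1 ≤ x then q.2 z else z

/-- The backward iterations of a sequence of marks sieved at `x`. -/
def sieveIter (x z₀ : ℝ) (s : ℕ → ℝ × LipFun) (n : ℕ) : ℝ :=
  backComp (fun i => sieveMap x (s i)) n z₀

theorem sieveIter_succ (x z₀ : ℝ) (s : ℕ → ℝ × LipFun) (n : ℕ) :
    sieveIter x z₀ s (n + 1) = sieveMap x (s 0) (sieveIter x z₀ (fun i => s (i + 1)) n) :=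
  backComp_succ' _ _ _

theorem composeAt_filter (x z₀ : ℝ) (s : ℕ → ℝ × LipFun) (l : List ℕ) :
    composeAt (((l.map s).filter fun q => q.1 ≤ x).map Prod.snd) z₀ =
      l.foldr (fun i w => sieveMap x (s i) w) z₀ := by
  induction l with
  | nil => rfl
  | cons i l ih =>
    by_cases h : (s i).1 ≤ x
    · simp only [List.map_cons, h, decide_true, List.filter_cons_of_pos, List.foldr_cons]
      rw [sieveMap, if_pos h, ← ih]
      rfl
    · simp only [List.map_cons, h, decide_false, List.filter_cons, List.foldr_cons]
      rw [sieveMap, if_neg h, ← ih]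
      simp

theorem IsTimeOrdered.eq {X : Type*} {S : Set (ℝ × X × LipFun)} {l l' : List (ℝ × X × LipFun)}
    (h : IsTimeOrdered S l) (h' : IsTimeOrdered S l') : l = l' := by
  have hn : ∀ {l : List (ℝ × X × LipFun)}, IsTimeOrdered S l → l.Nodup := fun h =>
    h.increasing.imp fun hlt heq => by rw [heq] at hlt; exact lt_irrefl _ hlt
  have hp : l.Perm l' := (List.perm_ext_iff_of_nodup (hn h) (hn h')).2 fun q => by
    rw [h.mem_iff, h'.mem_iff]
  exact hp.eq_of_pairwise (fun _ _ _ _ h1 h2 => absurd h1 (lt_asymm h2)) h.increasing h'.increasing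

theorem composeMarks_eq {X : Type*} {S : Set (ℝ × X × LipFun)} {l : List (ℝ × X × LipFun)}
    (h : IsTimeOrdered S l) (z₀ : ℝ) : composeMarks S z₀ = composeAt (l.map fun q => q.2.2) z₀ := by
  have hex : ∃ l, IsTimeOrdered S l := ⟨l, h⟩
  rw [composeMarks, dif_pos hex, hex.choose_spec.eq h]

/-- `N t` counts the points of the strip up to time `t`. It does not depend on `x`, because
discarding a mark amounts to composing with the identity; a single time change therefore serves all
`x ≤ X`. -/
theorem exists_sievedIter_eq {y : ℕ → ℝ × ℝ × LipFun} {X : ℝ}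
    (hU : ∀ n : ℕ, ∃! k, HasRank y (Set.Icc 0 X ×ˢ Set.univ) k n)
    (hF : ∀ T : ℕ, {k | y k ∈ Set.Icc (0 : ℝ) T ×ˢ (Set.Icc 0 X ×ˢ (Set.univ : Set LipFun))}.Finite) :
    ∃ N : ℝ → ℕ, Tendsto N atTop atTop ∧ ∀ x ≤ X, ∀ z₀ t, sievedIter y z₀ (Set.Icc 0 x) t =
      sieveIter x z₀ (fun n => rankMark y (Set.Icc 0 X ×ˢ Set.univ) n) (N t) := by
  set S : Set (ℝ × LipFun) := Set.Icc 0 X ×ˢ Set.univ with hS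
  set k : ℕ → ℕ := rankIndex y S with hk
  have hkr : ∀ n : ℕ, HasRank y S (k n) n := fun n => hasRank_rankIndex (hU n).exists
  set τ : ℕ → ℝ := fun n => (y (k n)).1 with hτ
  have hτmono : StrictMono τ := by
    -- If the point of rank `n + 1` came no later than the one of rank `n`, its predecessors would
    -- be among the `n` predecessors of the latter.
    refine strictMono_nat_of_lt_succ fun n => ?_
    by_contra hle
    have hsub : {l | y l ∈ Set.Ici (0 : ℝ) ×ˢ S ∧ (y l).1 < (y (k (n + 1))).1} ⊆
        {l | y l ∈ Set.Ici (0 : ℝ) ×ˢ S ∧ (y l).1 < (y (k n)).1} := fun l hl =>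
      ⟨hl.1, hl.2.trans_le (not_lt.1 hle)⟩
    have h1 := Set.encard_le_encard hsub
    have h2 := (hkr n).2
    have h3 := (hkr (n + 1)).2
    rw [timeRank] at h2 h3
    rw [h2, h3] at h1
    have := Nat.cast_le.1 h1
    omega
  -- Local finiteness gives every strip point a finite rank, and uniqueness of ranks identifies its
  -- index.
  have hsurj : ∀ l, y l ∈ Set.Ici (0 : ℝ) ×ˢ S → ∃ n, k n = l := by
    intro l hl
    obtain ⟨T, hT⟩ := exists_nat_ge (y l).1
    have hfin : {j | y j ∈ Set.Ici (0 : ℝ) ×ˢ S ∧ (y j).1 < (y l).1}.Finite :=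
      (hF T).subset fun j hj => ⟨⟨hj.1.1, hj.2.le.trans hT⟩, hj.1.2⟩
    obtain ⟨n, hn⟩ := ENat.ne_top_iff_exists.1 (Set.encard_ne_top_iff.2 hfin)
    exact ⟨n, (hU n).unique (hkr n) ⟨hl, hn.symm⟩⟩
  have hkinj : Function.Injective k := fun m n h => hτmono.injective (by simp only [hτ, h])
  have hex : ∀ t : ℝ, ∃ n, t < τ n := by
    intro t
    by_contra! hcon
    obtain ⟨T, hT⟩ := exists_nat_ge t
    refine Set.infinite_range_of_injective hkinj ((hF T).subset ?_)
    rintro _ ⟨n, rfl⟩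
    exact ⟨⟨(hkr n).1.1, (hcon n).trans hT⟩, (hkr n).1.2⟩
  classical
  set N : ℝ → ℕ := fun t => Nat.find (hex t) with hN
  have hNiff : ∀ t n, n < N t ↔ τ n ≤ t := by
    intro t n
    constructor
    · intro h
      exact not_lt.1 (Nat.find_min (hex t) h)
    · intro h
      by_contra hle
      exact absurd ((Nat.find_spec (hex t)).trans_le ((hτmono.monotone (not_lt.1 hle)).trans h))
        (lt_irrefl _)
  refine ⟨N, ?_, ?_⟩
  · refine tendsto_atTop.2 fun n => ?_
    filter_upwards [eventually_ge_atTop (τ n)] with t ht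
    exact ((hNiff t n).2 ht).le
  · intro x hx z₀ t
    have hord : IsTimeOrdered {q | q ∈ Set.range y ∧ q.1 ∈ Set.Icc 0 t ∧ q.2.1 ∈ Set.Icc 0 x}
        (((List.range (N t)).map fun n => y (k n)).filter fun q => q.2.1 ≤ x) := by
      constructor
      · intro q
        simp only [List.mem_filter, List.mem_map, List.mem_range, decide_eq_true_eq]
        constructor
        · rintro ⟨⟨n, hn, rfl⟩, hqx⟩
          exact ⟨⟨_, rfl⟩, ⟨(hkr n).1.1, (hNiff t n).1 hn⟩, ⟨(hkr n).1.2.1.1, hqx⟩⟩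
        · rintro ⟨⟨l, rfl⟩, ht, hqx⟩
          obtain ⟨n, rfl⟩ := hsurj l ⟨ht.1, ⟨hqx.1, hqx.2.trans hx⟩, Set.mem_univ _⟩
          exact ⟨⟨n, (hNiff t n).2 ht.2, rfl⟩, hqx.2⟩
      · refine List.Pairwise.filter _ (List.pairwise_map.2 ?_)
        exact List.pairwise_lt_range.imp fun h => hτmono h
    rw [sievedIter, composeMarks_eq hord, sieveIter, backComp, ← composeAt_filter]
    congr 1
    rw [show (fun q : ℝ × ℝ × LipFun => q.2.2) = Prod.snd ∘ Prod.snd from rfl, ← List.map_map]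
    congr 1
    simp only [List.filter_map, List.map_map]
    rfl

/-! ### Measurability of evaluation and Lipschitz constant -/

theorem LipFun.norm_def (f : LipFun) : ‖f‖ = |f 0| + lipConst f := rfl

theorem LipFun.sub_apply (f g : LipFun) (z : ℝ) : (f - g) z = f z - g z := rfl

theorem LipFun.abs_apply_sub_le (f g : LipFun) (z : ℝ) :
    |f z - g z| ≤ (1 + |z|) * ‖f - g‖ := by
  rw [← LipFun.sub_apply, LipFun.norm_def]
  have h1 := abs_sub_le_lipConst (f - g) 0 z
  have h2 := abs_sub_abs_le_abs_sub ((f - g) z) ((f - g) 0)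
  rw [zero_sub, abs_neg] at h1
  have h3 := lipConst_nonneg (f - g)
  have h4 := abs_nonneg ((f - g) 0)
  have h5 := abs_nonneg z
  nlinarith [mul_nonneg h5 h4]

theorem continuous_lipFun_apply (z : ℝ) : Continuous fun f : LipFun => f z := by
  refine (LipschitzWith.of_dist_le_mul (K := ⟨1 + |z|, by positivity⟩) fun f g => ?_).continuous
  have h := LipFun.abs_apply_sub_le f g z
  rw [← dist_eq_norm] at h
  exact h

theorem lipConst_le_add (f g : LipFun) : lipConst f ≤ lipConst g + lipConst (f - g) := by
  refine ciSup_le ?_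
  rintro ⟨⟨x, y⟩, hxy⟩
  rw [div_le_iff₀ (abs_pos.2 (sub_ne_zero.2 hxy)), add_mul]
  refine le_trans ?_ (add_le_add (abs_sub_le_lipConst g x y) (abs_sub_le_lipConst (f - g) x y))
  refine le_trans (le_of_eq ?_) (abs_add_le _ _)
  congr 1
  rw [LipFun.sub_apply, LipFun.sub_apply]
  ring

theorem continuous_lipConst : Continuous lipConst := by
  refine (LipschitzWith.of_le_add fun f g => ?_).continuous
  rw [dist_eq_norm, LipFun.norm_def]
  have := lipConst_le_add f g
  have := abs_nonneg ((f - g) 0)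
  linarith

theorem continuous_coe_lipFun (f : LipFun) : Continuous (f : ℝ → ℝ) := by
  obtain ⟨K, hK⟩ := f.2
  exact hK.continuous

/-- Evaluation is a Carathéodory function: continuous in the point, measurable in the function. -/
theorem measurable_lipFun_eval : Measurable fun q : LipFun × ℝ => q.1 q.2 := by
  have h : Measurable (Function.uncurry fun (z : ℝ) (f : LipFun) => f z) :=
    measurable_uncurry_of_continuous_of_measurable (u := fun (z : ℝ) (f : LipFun) => f z)
      (fun f => continuous_coe_lipFun f) fun z => (continuous_lipFun_apply z).measurable
  exact h.comp measurable_swap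

theorem measurable_sieveMap (x : ℝ) :
    Measurable fun q : (ℝ × LipFun) × ℝ => sieveMap x q.1 q.2 := by
  refine Measurable.ite (measurableSet_le measurable_fst.fst measurable_const) ?_ measurable_snd
  exact measurable_lipFun_eval.comp (measurable_fst.snd.prodMk measurable_snd)

theorem measurable_sieveIter (x z₀ : ℝ) (n : ℕ) :
    Measurable fun s : ℕ → ℝ × LipFun => sieveIter x z₀ s n := by
  induction n with
  | zero => exact measurable_const
  | succ n ih =>
    simp only [sieveIter_succ]
    have h : Measurable fun s : ℕ → ℝ × LipFun => fun i => s (i + 1) :=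
      measurable_pi_lambda _ fun i => measurable_pi_apply _
    exact (measurable_sieveMap x).comp ((measurable_pi_apply 0).prodMk (ih.comp h))

theorem measurable_backwardIter (z₀ : ℝ) (n : ℕ) :
    Measurable fun f : ℕ → LipFun => backwardIter f z₀ n := by
  have h : (fun f : ℕ → LipFun => backwardIter f z₀ n) =
      fun f => sieveIter 0 z₀ (fun i => (0, f i)) n := by
    funext f
    rw [backwardIter_eq_backComp, sieveIter]
    congr 1
    funext i z
    simp [sieveMap]
  rw [h]
  exact (measurable_sieveIter 0 z₀ n).comp
    (measurable_pi_lambda _ fun i => measurable_const.prodMk (measurable_pi_apply i))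

/-- The limit of the sieved backward iterations. -/
def sieveLim (x z₀ : ℝ) (s : ℕ → ℝ × LipFun) : ℝ := limsup (sieveIter x z₀ s) atTop

/-- Defining the limit as a limsup makes it measurable on all sequences, convergent or not. -/
theorem measurable_sieveLim (x z₀ : ℝ) : Measurable (sieveLim x z₀) :=
  Measurable.limsup fun n => measurable_sieveIter x z₀ n

/-! ### Sequences of independent marks -/

section IID

variable {α : Type*} [MeasurableSpace α] (κ : Measure α) [IsProbabilityMeasure κ]

/-- Prepending an independent mark preserves the i.i.d. law; this is what allows conditioning on the
first mark. -/
theorem map_infinitePi_cons :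
    (κ.prod (Measure.infinitePi fun _ : ℕ => κ)).map
      (fun q : α × (ℕ → α) => fun n => Nat.casesOn n q.1 q.2 : α × (ℕ → α) → ℕ → α) =
      Measure.infinitePi fun _ : ℕ => κ := by
  classical
  refine Measure.eq_infinitePi _ fun s t ht => ?_
  have hm : Measurable (fun q : α × (ℕ → α) => fun n => Nat.casesOn n q.1 q.2 :
      α × (ℕ → α) → ℕ → α) := by
    refine measurable_pi_lambda _ fun n => ?_
    cases n with
    | zero => exact measurable_fst
    | succ n => exact (measurable_pi_apply n).comp measurable_snd
  rw [Measure.map_apply hm (MeasurableSet.pi s.countable_toSet fun i _ => ht i)]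
  obtain ⟨n, hn⟩ := s.exists_nat_subset_range
  set t' : ℕ → Set α := fun i => if i ∈ s then t i else Set.univ with ht'
  have hmt : ∀ i, MeasurableSet (t' i) := fun i => by
    simp only [ht']; split_ifs; exacts [ht i, MeasurableSet.univ]
  have hset : ((fun q : α × (ℕ → α) => fun n => Nat.casesOn n q.1 q.2 :
      α × (ℕ → α) → ℕ → α) ⁻¹' Set.pi s t) =
      t' 0 ×ˢ Set.pi (Finset.range n) fun i => t' (i + 1) := by
    ext ⟨a, q⟩
    simp only [Set.mem_preimage, Set.mem_pi, Finset.mem_coe, Set.mem_prod, Finset.mem_range, ht']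
    constructor
    · intro h
      refine ⟨?_, fun i _ => ?_⟩
      · split_ifs with h0
        exacts [h 0 h0, Set.mem_univ _]
      · split_ifs with h0
        exacts [h (i + 1) h0, Set.mem_univ _]
    · rintro ⟨h0, h1⟩ i hi
      cases i with
      | zero => simpa [hi] using h0
      | succ i =>
        have := h1 i (by have := Finset.mem_range.1 (hn hi); omega)
        simpa [hi] using this
  rw [hset, Measure.prod_prod, Measure.infinitePi_pi _ fun i _ => hmt _, mul_comm,
    ← Finset.prod_range_succ' fun i => κ (t' i)]
  have hn' : s ⊆ Finset.range (n + 1) := hn.trans (Finset.range_mono (Nat.le_succ n))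
  rw [← Finset.prod_subset hn' fun i _ hi => by simp [ht', hi]]
  exact Finset.prod_congr rfl fun i hi => by simp [ht', hi]

theorem lintegral_infinitePi_cons {H : (ℕ → α) → ℝ≥0∞} (hH : Measurable H) :
    ∫⁻ s, H s ∂(Measure.infinitePi fun _ : ℕ => κ) =
      ∫⁻ q, ∫⁻ s, H (fun n => Nat.casesOn n q s) ∂(Measure.infinitePi fun _ : ℕ => κ) ∂κ := by
  have hm : Measurable (fun q : α × (ℕ → α) => fun n => Nat.casesOn n q.1 q.2 :
      α × (ℕ → α) → ℕ → α) := by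
    refine measurable_pi_lambda _ fun n => ?_
    cases n with
    | zero => exact measurable_fst
    | succ n => exact (measurable_pi_apply n).comp measurable_snd
  conv_lhs => rw [← map_infinitePi_cons κ]
  rw [lintegral_map hH hm]
  exact lintegral_prod _ (hH.comp hm).aemeasurable

theorem lintegral_prod_mul_infinitePi {M D : α → ℝ≥0∞} (hM : Measurable M) (hD : Measurable D)
    (n : ℕ) :
    ∫⁻ s, (∏ i ∈ Finset.range n, M (s i)) * D (s n) ∂(Measure.infinitePi fun _ : ℕ => κ) =
      (∫⁻ q, M q ∂κ) ^ n * ∫⁻ q, D q ∂κ := by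
  -- The factors `M` and the last factor `D` are put in one independent family.
  have hX : ∀ i : ℕ, Measurable fun q => if i < n then M q else D q := fun i => by
    split_ifs <;> assumption
  have hind := iIndepFun_infinitePi (P := fun _ : ℕ => κ)
    (X := fun i q => if i < n then M q else D q) hX
  have h := lintegral_prod_eq_prod_lintegral_of_indepFun (Finset.range (n + 1))
    (fun (i : ℕ) (s : ℕ → α) => if i < n then M (s i) else D (s i)) hind
    fun i => (hX i).comp (measurable_pi_apply i)
  have hev : ∀ (i : ℕ) (f : α → ℝ≥0∞), Measurable f →
      ∫⁻ s, f (s i) ∂(Measure.infinitePi fun _ : ℕ => κ) = ∫⁻ q, f q ∂κ := fun i f hf => by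
    have := (measurePreserving_eval_infinitePi (fun _ : ℕ => κ) i).lintegral_comp hf
    exact this
  simp only [Finset.prod_range_succ, lt_irrefl, if_false] at h
  rw [hev n D hD] at h
  convert h using 2
  · funext s
    congr 1
    exact Finset.prod_congr rfl fun i hi => by rw [if_pos (Finset.mem_range.1 hi)]
  · rw [Finset.prod_congr rfl fun i hi => ?_, Finset.prod_const, Finset.card_range]
    simp only [if_pos (Finset.mem_range.1 hi)]
    exact hev i M hM

theorem ENNReal.sum_rpow_le_sum_rpow {ι : Type*} (s : Finset ι) (f : ι → ℝ≥0∞) {p : ℝ}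
    (hp0 : 0 < p) (hp1 : p ≤ 1) : (∑ i ∈ s, f i) ^ p ≤ ∑ i ∈ s, f i ^ p := by
  classical
  induction s using Finset.induction_on with
  | empty => simp [hp0]
  | insert i s hi ih =>
    rw [Finset.sum_insert hi, Finset.sum_insert hi]
    exact (ENNReal.rpow_add_le_add_rpow _ _ hp0.le hp1).trans (add_le_add le_rfl ih)

theorem ENNReal.tsum_rpow_le_tsum_rpow {ι : Type*} (f : ι → ℝ≥0∞) {p : ℝ}
    (hp0 : 0 < p) (hp1 : p ≤ 1) : (∑' i, f i) ^ p ≤ ∑' i, f i ^ p := by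
  refine le_of_tendsto (((ENNReal.continuous_rpow_const (y := p)).tendsto _).comp
    ENNReal.summable.hasSum) (Eventually.of_forall fun s => ?_)
  exact (ENNReal.sum_rpow_le_sum_rpow s f hp0 hp1).trans (ENNReal.sum_le_tsum s)

/-- For `p ≤ 1` the power moves inside the sum, and independence turns the expectations into a
geometric series with ratio `E M^p < 1`. -/
theorem lintegral_rpow_tsum_lt_top {M D : α → ℝ} (hM : Measurable M) (hD : Measurable D)
    (hM0 : ∀ q, 0 ≤ M q) (hD0 : ∀ q, 0 ≤ D q) {p : ℝ} (hp0 : 0 < p) (hp1 : p ≤ 1)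
    (hr : ∫⁻ q, ENNReal.ofReal (M q ^ p) ∂κ < 1) (hd : ∫⁻ q, ENNReal.ofReal (D q ^ p) ∂κ < ∞) :
    ∫⁻ s, (∑' n, ENNReal.ofReal ((∏ i ∈ Finset.range n, M (s i)) * D (s n))) ^ p
      ∂(Measure.infinitePi fun _ : ℕ => κ) < ∞ := by
  have hMp : Measurable fun q => ENNReal.ofReal (M q ^ p) := (hM.pow_const p).ennreal_ofReal
  have hDp : Measurable fun q => ENNReal.ofReal (D q ^ p) := (hD.pow_const p).ennreal_ofReal
  calc _ ≤ ∫⁻ s, ∑' n, (∏ i ∈ Finset.range n, ENNReal.ofReal (M (s i) ^ p)) *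
          ENNReal.ofReal (D (s n) ^ p) ∂(Measure.infinitePi fun _ : ℕ => κ) := by
        refine lintegral_mono fun s => (ENNReal.tsum_rpow_le_tsum_rpow _ hp0 hp1).trans
          (le_of_eq (tsum_congr fun n => ?_))
        have h0 := Finset.prod_nonneg fun i (_ : i ∈ Finset.range n) => hM0 (s i)
        rw [ENNReal.ofReal_rpow_of_nonneg (mul_nonneg h0 (hD0 _)) hp0.le,
          Real.mul_rpow h0 (hD0 _), ENNReal.ofReal_mul (Real.rpow_nonneg h0 p),
          ← Real.finsetProd_rpow _ _ fun i _ => hM0 (s i),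
          ENNReal.ofReal_prod_of_nonneg fun i _ => Real.rpow_nonneg (hM0 _) p]
    _ = ∑' n, (∫⁻ q, ENNReal.ofReal (M q ^ p) ∂κ) ^ n * ∫⁻ q, ENNReal.ofReal (D q ^ p) ∂κ := by
        rw [lintegral_tsum]
        · exact tsum_congr fun n => lintegral_prod_mul_infinitePi κ hMp hDp n
        · intro n
          exact ((Finset.measurable_prod _ fun i _ => hMp.comp (measurable_pi_apply i)).mul
            (hDp.comp (measurable_pi_apply n))).aemeasurable
    _ < ∞ := by
        rw [ENNReal.tsum_mul_right, ENNReal.tsum_geometric]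
        refine ENNReal.mul_lt_top (ENNReal.inv_lt_top.2 (tsub_pos_of_lt hr)) hd

theorem ae_summable_prod_mul {M D : α → ℝ} (hM : Measurable M) (hD : Measurable D)
    (hM0 : ∀ q, 0 ≤ M q) (hD0 : ∀ q, 0 ≤ D q) {p : ℝ} (hp0 : 0 < p) (hp1 : p ≤ 1)
    (hr : ∫⁻ q, ENNReal.ofReal (M q ^ p) ∂κ < 1) (hd : ∫⁻ q, ENNReal.ofReal (D q ^ p) ∂κ < ∞) :
    ∀ᵐ s ∂(Measure.infinitePi fun _ : ℕ => κ),
      Summable fun n => (∏ i ∈ Finset.range n, M (s i)) * D (s n) := by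
  have hmeas : Measurable fun s : ℕ → α =>
      (∑' n, ENNReal.ofReal ((∏ i ∈ Finset.range n, M (s i)) * D (s n))) ^ p := by
    refine (Measurable.tsum fun n => ?_).pow_const p
    exact ((Finset.measurable_prod _ fun i _ => hM.comp (measurable_pi_apply i)).mul
      (hD.comp (measurable_pi_apply n))).ennreal_ofReal
  filter_upwards [ae_lt_top hmeas (lintegral_rpow_tsum_lt_top κ hM hD hM0 hD0 hp0 hp1 hr hd).ne]
    with s hs
  have h1 : ∑' n, ENNReal.ofReal ((∏ i ∈ Finset.range n, M (s i)) * D (s n)) ≠ ∞ := by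
    intro h
    rw [h, ENNReal.top_rpow_of_pos hp0] at hs
    exact lt_irrefl _ hs
  have h2 := ENNReal.summable_toReal h1
  refine h2.congr fun n => ENNReal.toReal_ofReal ?_
  exact mul_nonneg (Finset.prod_nonneg fun i _ => hM0 _) (hD0 _)

end IID

/-! ### The law of a mark -/

/-- The uniform distribution on `[0, X]`. -/
def unifLaw (X : ℝ) : Measure ℝ := volume[|Set.Icc 0 X]

/-- The law of a position that is uniform on `[0, X]` and an independent random function. -/
def markLaw (X : ℝ) (ν : Measure LipFun) : Measure (ℝ × LipFun) := (unifLaw X).prod ν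

section MarkLaw

variable {X : ℝ}

theorem isProbabilityMeasure_unifLaw (hX : 0 < X) : IsProbabilityMeasure (unifLaw X) :=
  cond_isProbabilityMeasure_of_finite (by simpa using hX) (by simp)

instance : SFinite (unifLaw X) := by unfold unifLaw ProbabilityTheory.cond; infer_instance

theorem unifLaw_Iic (hX : 0 < X) {x : ℝ} (hxX : x ≤ X) :
    unifLaw X (Set.Iic x) = ENNReal.ofReal (x / X) := by
  have h : Set.Icc 0 X ∩ Set.Iic x = Set.Icc 0 x := by
    ext y
    exact ⟨fun hy => ⟨hy.1.1, hy.2⟩, fun hy => ⟨⟨hy.1, hy.2.trans hxX⟩, hy.2⟩⟩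
  rw [unifLaw, cond_apply measurableSet_Icc, h, Real.volume_Icc, Real.volume_Icc, sub_zero,
    sub_zero, ENNReal.ofReal_div_of_pos hX, ENNReal.div_eq_inv_mul]

theorem unifLaw_Ioi (hX : 0 < X) {x : ℝ} (hx : 0 ≤ x) (hxX : x ≤ X) :
    unifLaw X (Set.Ioi x) = ENNReal.ofReal (1 - x / X) := by
  have := isProbabilityMeasure_unifLaw hX
  rw [← Set.compl_Iic, prob_compl_eq_one_sub measurableSet_Iic, unifLaw_Iic hX hxX,
    ENNReal.ofReal_sub _ (by positivity), ENNReal.ofReal_one]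

theorem cond_eq_markLaw (ν : Measure LipFun) [IsProbabilityMeasure ν] :
    (lebHalfLine.prod ν)[|Set.Icc 0 X ×ˢ Set.univ] = markLaw X ν := by
  have h1 : (lebHalfLine.prod ν) (Set.Icc 0 X ×ˢ Set.univ) = volume (Set.Icc 0 X) := by
    rw [Measure.prod_prod, measure_univ, mul_one,
      lebHalfLine_apply_of_subset Set.Icc_subset_Ici_self]
  have h2 : lebHalfLine.restrict (Set.Icc 0 X) = volume.restrict (Set.Icc 0 X) := by
    rw [lebHalfLine, Measure.restrict_restrict measurableSet_Icc,
      Set.inter_eq_left.2 Set.Icc_subset_Ici_self]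
  rw [ProbabilityTheory.cond, h1, ← Measure.prod_restrict, h2, Measure.restrict_univ, markLaw,
    unifLaw, ProbabilityTheory.cond, Measure.prod_smul_left]

theorem lintegral_markLaw_indicator {ν : Measure LipFun} [IsProbabilityMeasure ν] {B : Set ℝ}
    (hB : MeasurableSet B) {h : LipFun → ℝ≥0∞} (hh : Measurable h) :
    ∫⁻ q, B.indicator 1 q.1 * h q.2 ∂(markLaw X ν) = unifLaw X B * ∫⁻ f, h f ∂ν := by
  rw [markLaw, lintegral_prod_mul (f := B.indicator 1)
    (measurable_const.indicator hB).aemeasurable hh.aemeasurable, lintegral_indicator_one hB]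

theorem ae_markLaw_le (hX : 0 < X) (ν : Measure LipFun) [IsProbabilityMeasure ν] :
    ∀ᵐ q ∂(markLaw X ν), q.1 ≤ X := by
  have h : ∀ᵐ x ∂(unifLaw X), x ≤ X := by
    have := unifLaw_Ioi hX hX.le le_rfl
    rw [div_self hX.ne', sub_self, ENNReal.ofReal_zero] at this
    filter_upwards [compl_mem_ae_iff.2 this] with x hx
    simpa using hx
  have := isProbabilityMeasure_unifLaw hX
  exact Measure.quasiMeasurePreserving_fst.ae h

end MarkLaw

/-! ### Convergence of the sieved iterations -/

/-- A common Lipschitz constant of the maps `sieveMap x q` with `x ∈ [a, b]`. -/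
def sieveLip (a b : ℝ) (q : ℝ × LipFun) : ℝ :=
  if q.1 ≤ a then lipConst q.2 else if q.1 ≤ b then max (lipConst q.2) 1 else 1

theorem sieveLip_nonneg (a b : ℝ) (q : ℝ × LipFun) : 0 ≤ sieveLip a b q := by
  unfold sieveLip
  split_ifs
  exacts [lipConst_nonneg _, zero_le_one.trans (le_max_right _ _), zero_le_one]

theorem measurable_sieveLip (a b : ℝ) : Measurable (sieveLip a b) := by
  have h : Measurable fun q : ℝ × LipFun => lipConst q.2 :=
    continuous_lipConst.measurable.comp measurable_snd
  exact Measurable.ite (measurableSet_le measurable_fst measurable_const) h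
    (Measurable.ite (measurableSet_le measurable_fst measurable_const) (h.max measurable_const)
      measurable_const)

/-- A position up to `a` is kept for every `x ∈ [a, b]` and one beyond `b` for none. In between the
map may be `f` or the identity, hence the maximum with `1`. -/
theorem abs_sieveMap_sub_le {a b x : ℝ} (hx : x ∈ Set.Icc a b) (q : ℝ × LipFun) (z w : ℝ) :
    |sieveMap x q z - sieveMap x q w| ≤ sieveLip a b q * |z - w| := by
  have h := abs_sub_le_lipConst q.2 w z
  rw [abs_sub_comm w z] at h
  have h0 := abs_nonneg (z - w)
  unfold sieveMap sieveLip
  by_cases h1 : q.1 ≤ x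
  · rw [if_pos h1, if_pos h1]
    split_ifs with h2 h3
    · exact h
    · exact h.trans (mul_le_mul_of_nonneg_right (le_max_left _ _) h0)
    · exact absurd (h1.trans hx.2) h3
  · rw [if_neg h1, if_neg h1, if_neg fun h => h1 (h.trans hx.1)]
    split_ifs
    · exact le_mul_of_one_le_left h0 (le_max_right _ _)
    · rw [one_mul]

theorem abs_sieveMap_sub_self_le (x z₀ : ℝ) (q : ℝ × LipFun) :
    |sieveMap x q z₀ - z₀| ≤ |q.2 z₀ - z₀| := by
  unfold sieveMap
  split_ifs
  · exact le_rfl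
  · simp

theorem continuous_sieveMap (x : ℝ) (q : ℝ × LipFun) : Continuous (sieveMap x q) := by
  unfold sieveMap
  split_ifs
  exacts [continuous_coe_lipFun q.2, continuous_id]

/-- Only `n` positions matter, and none of them lies in a sufficiently short interval `(x, x + ε)`.
To the left of `x` this fails if `x` itself is a position. -/
theorem eventually_sieveIter_eq (x z₀ : ℝ) (s : ℕ → ℝ × LipFun) (n : ℕ) :
    ∀ᶠ y in 𝓝[≥] x, sieveIter y z₀ s n = sieveIter x z₀ s n := by
  induction n generalizing s with
  | zero => exact Eventually.of_forall fun _ => rfl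
  | succ n ih =>
    have h : ∀ᶠ y in 𝓝[≥] x, ((s 0).1 ≤ y ↔ (s 0).1 ≤ x) := by
      by_cases h0 : (s 0).1 ≤ x
      · filter_upwards [self_mem_nhdsWithin] with y hy
        exact iff_of_true (h0.trans hy) h0
      · filter_upwards [mem_nhdsWithin_of_mem_nhds (Iio_mem_nhds (not_le.1 h0))] with y hy
        exact iff_of_false (not_le.2 hy) h0
    filter_upwards [ih fun i => s (i + 1), h] with y h1 h2
    rw [sieveIter_succ, sieveIter_succ, h1]
    simp only [sieveMap, h2]

/-- The increments that dominate those of the sieved iterations with `x ∈ [a, b]`. -/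
def sieveBound (a b z₀ : ℝ) (s : ℕ → ℝ × LipFun) (n : ℕ) : ℝ :=
  (∏ i ∈ Finset.range n, sieveLip a b (s i)) * |(s n).2 z₀ - z₀|

theorem tendsto_sieveIter {a b x z₀ : ℝ} {s : ℕ → ℝ × LipFun} (hs : Summable (sieveBound a b z₀ s))
    (hx : x ∈ Set.Icc a b) :
    Tendsto (sieveIter x z₀ s) atTop (𝓝 (sieveLim x z₀ s)) ∧
      ∀ n, |sieveIter x z₀ s n - sieveLim x z₀ s| ≤ ∑' k, sieveBound a b z₀ s (n + k) := by
  obtain ⟨z, hz, hb⟩ := exists_tendsto_backComp (φ := fun i => sieveMap x (s i)) (z₀ := z₀)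
    (M := fun i => sieveLip a b (s i)) (D := fun i => |(s i).2 z₀ - z₀|)
    (fun i => sieveLip_nonneg a b _) (fun i z w => abs_sieveMap_sub_le hx _ z w)
    (fun i => abs_sieveMap_sub_self_le x z₀ _) hs
  have hz' : Tendsto (sieveIter x z₀ s) atTop (𝓝 z) := hz
  have : sieveLim x z₀ s = z := hz'.limsup_eq
  rw [this]
  exact ⟨hz', hb⟩

/-- A uniform limit on `[a, b]` of functions locally constant to the right is right-continuous. -/
theorem continuousWithinAt_sieveLim {a b x z₀ : ℝ} {s : ℕ → ℝ × LipFun}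
    (hs : Summable (sieveBound a b z₀ s)) (hx : x ∈ Set.Icc a b) :
    ContinuousWithinAt (fun y => sieveLim y z₀ s) (Set.Icc x b) x := by
  rw [ContinuousWithinAt, Metric.tendsto_nhds]
  intro ε hε
  have htail : Tendsto (fun n => ∑' k, sieveBound a b z₀ s (n + k)) atTop (𝓝 0) := by
    simpa only [add_comm] using tendsto_sum_nat_add (sieveBound a b z₀ s)
  obtain ⟨n, hn⟩ := (htail.eventually (gt_mem_nhds (half_pos hε))).exists
  filter_upwards [nhdsWithin_mono x Set.Icc_subset_Ici_self (eventually_sieveIter_eq x z₀ s n),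
    self_mem_nhdsWithin] with y hy hyb
  have h1 := (tendsto_sieveIter hs hx).2 n
  have h2 := (tendsto_sieveIter hs ⟨hx.1.trans hyb.1, hyb.2⟩).2 n
  rw [hy, abs_sub_comm] at h2
  have h3 := abs_sub_le (sieveLim y z₀ s) (sieveIter x z₀ s n) (sieveLim x z₀ s)
  rw [Real.dist_eq]
  linarith

/-! ### Moments and almost sure convergence for i.i.d. marks -/

section Law

variable {ν : Measure LipFun} [IsProbabilityMeasure ν] {X p : ℝ}

theorem measurable_lipConst_rpow (p : ℝ) :
    Measurable fun f : LipFun => ENNReal.ofReal (lipConst f ^ p) :=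
  (continuous_lipConst.measurable.pow_const p).ennreal_ofReal

/-- Since `max(L, 1)^p ≤ L^p + 1`, the moment is at most `(b/X) Φ(p) + 1 - a/X`, which is below `1`
exactly because `b Φ(p) < a`. -/
theorem lintegral_sieveLip_rpow_lt_one (hX : 0 < X) (hΦ : lipMoment ν p < 1)
    {a b : ℝ} (ha : 0 < a) (hab : a ≤ b) (hbX : b ≤ X) (hlt : b * (lipMoment ν p).toReal < a) :
    ∫⁻ q, ENNReal.ofReal (sieveLip a b q ^ p) ∂(markLaw X ν) < 1 := by
  have hm := measurable_lipConst_rpow p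
  have hind : ∀ B : Set ℝ, MeasurableSet B →
      Measurable fun q : ℝ × LipFun => B.indicator (1 : ℝ → ℝ≥0∞) q.1 := fun B hB =>
    (measurable_one.indicator hB).comp measurable_fst
  calc _ ≤ ∫⁻ q, (Set.Iic b).indicator 1 q.1 * ENNReal.ofReal (lipConst q.2 ^ p) +
          (Set.Ioi a).indicator 1 q.1 * 1 ∂(markLaw X ν) := by
        refine lintegral_mono fun q => ?_
        have hL := lipConst_nonneg q.2
        unfold sieveLip
        by_cases h1 : q.1 ≤ a
        · rw [if_pos h1, Set.indicator_of_mem (show q.1 ∈ Set.Iic b from h1.trans hab)]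
          simp
        · have h1' : q.1 ∈ Set.Ioi a := not_le.1 h1
          rw [if_neg h1, Set.indicator_of_mem h1']
          by_cases h2 : q.1 ≤ b
          · rw [if_pos h2, Set.indicator_of_mem (show q.1 ∈ Set.Iic b from h2)]
            simp only [Pi.one_apply, one_mul]
            rcases le_total (lipConst q.2) 1 with h | h
            · rw [max_eq_right h]; simp
            · rw [max_eq_left h]; exact le_self_add
          · rw [if_neg h2]; simp
    _ = ENNReal.ofReal (b / X) * lipMoment ν p + ENNReal.ofReal (1 - a / X) := by
        have hmeas : Measurable fun q : ℝ × LipFun => (Set.Iic b).indicator (1 : ℝ → ℝ≥0∞) q.1 *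
            ENNReal.ofReal (lipConst q.2 ^ p) :=
          (hind _ measurableSet_Iic).mul (hm.comp measurable_snd)
        rw [lintegral_add_left hmeas,
          lintegral_markLaw_indicator measurableSet_Iic hm,
          lintegral_markLaw_indicator measurableSet_Ioi measurable_const,
          unifLaw_Iic hX hbX, unifLaw_Ioi hX ha.le (hab.trans hbX)]
        simp [lipMoment]
    _ < 1 := by
        have hb : 0 < b := ha.trans_le hab
        have haX : a / X ≤ 1 := (div_le_one hX).2 (hab.trans hbX)
        rw [← ENNReal.ofReal_toReal (hΦ.trans ENNReal.one_lt_top).ne, ← ENNReal.ofReal_mul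
          (by positivity), ← ENNReal.ofReal_add (by positivity) (by linarith),
          ← ENNReal.ofReal_one]
        refine (ENNReal.ofReal_lt_ofReal_iff one_pos).2 ?_
        have : b / X * (lipMoment ν p).toReal < a / X := by
          rw [div_mul_eq_mul_div]
          exact div_lt_div_of_pos_right hlt hX
        linarith

theorem lintegral_displacement_rpow_lt_top {z₀ : ℝ} (hX : 0 < X) (hp0 : 0 < p) (hp1 : p ≤ 1)
    (hν : ∫⁻ f : LipFun, ENNReal.ofReal |f z₀ - z₀| ∂ν < ∞) :
    ∫⁻ q, ENNReal.ofReal (|q.2 z₀ - z₀| ^ p) ∂(markLaw X ν) < ∞ := by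
  have := isProbabilityMeasure_unifLaw hX
  have hm : Measurable fun f : LipFun => |f z₀ - z₀| :=
    ((continuous_lipFun_apply z₀).sub continuous_const).abs.measurable
  have h := lintegral_markLaw_indicator (X := X) (ν := ν) MeasurableSet.univ
    (hm.pow_const p).ennreal_ofReal
  simp only [Set.indicator_univ, Pi.one_apply, one_mul, measure_univ] at h
  rw [h]
  calc _ ≤ ∫⁻ f : LipFun, 1 + ENNReal.ofReal |f z₀ - z₀| ∂ν := by
        refine lintegral_mono fun f => ?_
        rw [← ENNReal.ofReal_one, ← ENNReal.ofReal_add zero_le_one (abs_nonneg _)]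
        refine ENNReal.ofReal_le_ofReal ?_
        rcases le_total |f z₀ - z₀| 1 with h | h
        · exact (Real.rpow_le_one (abs_nonneg _) h hp0.le).trans (by linarith [abs_nonneg (f z₀ - z₀)])
        · exact (Real.rpow_le_self_of_one_le h hp1).trans (by linarith)
    _ < ∞ := by
        rw [lintegral_add_left measurable_const]
        simpa using hν

/-- The law of a sequence of independent marks. -/
def seqLaw (X : ℝ) (ν : Measure LipFun) : Measure (ℕ → ℝ × LipFun) :=
  Measure.infinitePi fun _ => markLaw X ν

theorem isProbabilityMeasure_markLaw (hX : 0 < X) : IsProbabilityMeasure (markLaw X ν) := by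
  have := isProbabilityMeasure_unifLaw hX
  unfold markLaw
  infer_instance

theorem isProbabilityMeasure_seqLaw (hX : 0 < X) : IsProbabilityMeasure (seqLaw X ν) := by
  have := isProbabilityMeasure_markLaw (ν := ν) hX
  unfold seqLaw
  infer_instance

theorem measurable_displacement (z₀ : ℝ) :
    Measurable fun q : ℝ × LipFun => |q.2 z₀ - z₀| :=
  ((continuous_lipFun_apply z₀).sub continuous_const).abs.measurable.comp measurable_snd

theorem ae_summable_sieveBound {z₀ : ℝ} (hX : 0 < X) (hp0 : 0 < p) (hp1 : p ≤ 1)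
    (hΦ : lipMoment ν p < 1) (hν : ∫⁻ f : LipFun, ENNReal.ofReal |f z₀ - z₀| ∂ν < ∞)
    {a b : ℝ} (ha : 0 < a) (hab : a ≤ b) (hbX : b ≤ X) (hlt : b * (lipMoment ν p).toReal < a) :
    ∀ᵐ s ∂(seqLaw X ν), Summable (sieveBound a b z₀ s) := by
  have := isProbabilityMeasure_markLaw (ν := ν) hX
  have h := ae_summable_prod_mul (markLaw X ν) (measurable_sieveLip a b)
    (measurable_displacement z₀) (sieveLip_nonneg a b) (fun _ => abs_nonneg _) hp0 hp1
    (lintegral_sieveLip_rpow_lt_one hX hΦ ha hab hbX hlt)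
    (lintegral_displacement_rpow_lt_top hX hp0 hp1 hν)
  unfold seqLaw sieveBound
  exact h

/-- The uniform estimate needs a short interval. As `x Φ(p) < x`, every `x ∈ (0, X]` lies in one
described by two rationals, so countably many null sets suffice for all `x` at once. -/
theorem ae_tendsto_sieveIter {z₀ : ℝ} (hX : 0 < X) (hp0 : 0 < p) (hp1 : p ≤ 1)
    (hΦ : lipMoment ν p < 1) (hν : ∫⁻ f : LipFun, ENNReal.ofReal |f z₀ - z₀| ∂ν < ∞) :
    ∀ᵐ s ∂(seqLaw X ν), ∀ x, 0 < x → x ≤ X →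
      Tendsto (sieveIter x z₀ s) atTop (𝓝 (sieveLim x z₀ s)) ∧
      ContinuousWithinAt (fun y => sieveLim y z₀ s) (Set.Icc x X) x := by
  set φ := (lipMoment ν p).toReal with hφ
  have hφ1 : φ < 1 := by
    rw [hφ, ← ENNReal.toReal_one]
    exact (ENNReal.toReal_lt_toReal (hΦ.trans ENNReal.one_lt_top).ne ENNReal.one_ne_top).2 hΦ
  have hφ0 : 0 ≤ φ := ENNReal.toReal_nonneg
  -- The right end is cut at `X`, so that `x = X` is covered without leaving the strip.
  have h : ∀ᵐ s ∂(seqLaw X ν), ∀ q : ℚ × ℚ, 0 < (q.1 : ℝ) → (q.1 : ℝ) ≤ min (q.2 : ℝ) X →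
      min (q.2 : ℝ) X * φ < q.1 → Summable (sieveBound q.1 (min (q.2 : ℝ) X) z₀ s) := by
    refine ae_all_iff.2 fun q => ?_
    by_cases hq : 0 < (q.1 : ℝ) ∧ (q.1 : ℝ) ≤ min (q.2 : ℝ) X ∧ min (q.2 : ℝ) X * φ < q.1
    · filter_upwards [ae_summable_sieveBound hX hp0 hp1 hΦ hν hq.1 hq.2.1 (min_le_right _ _)
        hq.2.2] with s hs _ _ _
      exact hs
    · exact Eventually.of_forall fun s h1 h2 h3 => absurd ⟨h1, h2, h3⟩ hq
  filter_upwards [h] with s hs x hx hxX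
  obtain ⟨q₁, h1, h1x⟩ := exists_rat_btwn (show max 0 (x * φ) < x from
    max_lt hx (by nlinarith))
  have hq0 : 0 < (q₁ : ℝ) := (le_max_left _ _).trans_lt h1
  have hqφ : x * φ < q₁ := (le_max_right _ _).trans_lt h1
  obtain ⟨q₂, h2x, h2⟩ : ∃ q₂ : ℚ, x < q₂ ∧ (q₂ : ℝ) * φ < q₁ := by
    have : ∀ᶠ y in 𝓝 x, y * φ < q₁ :=
      (continuous_id.mul continuous_const).continuousAt.eventually (gt_mem_nhds hqφ)
    obtain ⟨ε, hε, hball⟩ := Metric.eventually_nhds_iff.1 this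
    obtain ⟨q₂, h3, h4⟩ := exists_rat_btwn (show x < x + ε by linarith)
    refine ⟨q₂, h3, hball ?_⟩
    rw [Real.dist_eq, abs_of_pos (by linarith)]
    linarith
  have hmin : min (q₂ : ℝ) X * φ < q₁ :=
    (mul_le_mul_of_nonneg_right (min_le_left _ _) hφ0).trans_lt h2
  have hsum := hs (q₁, q₂) hq0 (le_min (h1x.trans h2x).le (h1x.le.trans hxX)) hmin
  have hmem : x ∈ Set.Icc (q₁ : ℝ) (min q₂ X) := ⟨h1x.le, le_min h2x.le hxX⟩
  refine ⟨(tendsto_sieveIter hsum hmem).1, ?_⟩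
  refine (continuousWithinAt_sieveLim hsum hmem).mono_of_mem_nhdsWithin ?_
  filter_upwards [self_mem_nhdsWithin, mem_nhdsWithin_of_mem_nhds (Iio_mem_nhds h2x)] with y hy hy2
  exact ⟨hy.1, le_min (Set.mem_Iio.1 hy2).le hy.2⟩

theorem lintegral_sieveLim_rpow_lt_top {z₀ : ℝ} (hX : 0 < X) (hp0 : 0 < p) (hp1 : p ≤ 1)
    (hΦ : lipMoment ν p < 1) (hν : ∫⁻ f : LipFun, ENNReal.ofReal |f z₀ - z₀| ∂ν < ∞) :
    ∫⁻ s, ENNReal.ofReal (|sieveLim X z₀ s| ^ p) ∂(seqLaw X ν) < ∞ := by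
  have := isProbabilityMeasure_markLaw (ν := ν) hX
  have := isProbabilityMeasure_seqLaw (ν := ν) hX
  have hlt : X * (lipMoment ν p).toReal < X := by
    have : (lipMoment ν p).toReal < 1 := by
      rw [← ENNReal.toReal_one]
      exact (ENNReal.toReal_lt_toReal (hΦ.trans ENNReal.one_lt_top).ne ENNReal.one_ne_top).2 hΦ
    nlinarith
  have hb := lintegral_rpow_tsum_lt_top (markLaw X ν) (measurable_sieveLip X X)
    (measurable_displacement z₀) (sieveLip_nonneg X X) (fun _ => abs_nonneg _) hp0 hp1
    (lintegral_sieveLip_rpow_lt_one hX hΦ hX le_rfl le_rfl hlt)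
    (lintegral_displacement_rpow_lt_top hX hp0 hp1 hν)
  calc _ ≤ ∫⁻ s, ENNReal.ofReal |z₀| ^ p + (∑' n, ENNReal.ofReal (sieveBound X X z₀ s n)) ^ p
          ∂(seqLaw X ν) := by
        refine lintegral_mono_ae ?_
        filter_upwards [ae_summable_sieveBound hX hp0 hp1 hΦ hν hX le_rfl le_rfl hlt] with s hs
        -- The tail bound from index `0` controls the distance of the limit from the starting point
        -- `z₀`.
        have h1 := (tendsto_sieveIter hs (Set.right_mem_Icc.2 le_rfl)).2 0
        simp only [zero_add] at h1
        have h0 : sieveIter X z₀ s 0 = z₀ := rfl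
        rw [h0, abs_sub_comm] at h1
        have h2 : |sieveLim X z₀ s| ≤ |z₀| + ∑' n, sieveBound X X z₀ s n := by
          have := abs_sub_abs_le_abs_sub (sieveLim X z₀ s) z₀
          linarith
        have hnn : ∀ n, 0 ≤ sieveBound X X z₀ s n := fun n =>
          mul_nonneg (Finset.prod_nonneg fun i _ => sieveLip_nonneg _ _ _) (abs_nonneg _)
        rw [← ENNReal.ofReal_rpow_of_nonneg (abs_nonneg _) hp0.le]
        refine le_trans ?_ (ENNReal.rpow_add_le_add_rpow _ _ hp0.le hp1)
        refine ENNReal.rpow_le_rpow ?_ hp0.le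
        rw [← ENNReal.ofReal_tsum_of_nonneg hnn hs, ← ENNReal.ofReal_add (abs_nonneg _)
          (tsum_nonneg hnn)]
        exact ENNReal.ofReal_le_ofReal h2
    _ < ∞ := by
        rw [lintegral_add_left measurable_const, lintegral_const, measure_univ, mul_one]
        exact ENNReal.add_lt_top.2
          ⟨ENNReal.rpow_lt_top_of_nonneg hp0.le ENNReal.ofReal_ne_top, hb⟩

end Law

/-! ### Increments of the sieved limit -/

/-- The first map is outermost and continuous, so it commutes with the limit. -/
theorem sieveLim_cons {x z₀ : ℝ} {s : ℕ → ℝ × LipFun} (q : ℝ × LipFun)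
    (hs : Tendsto (sieveIter x z₀ s) atTop (𝓝 (sieveLim x z₀ s))) :
    sieveLim x z₀ (fun n => Nat.casesOn n q s) = sieveMap x q (sieveLim x z₀ s) := by
  have h1 : Tendsto (fun n => sieveIter x z₀ (fun n => Nat.casesOn n q s) (n + 1)) atTop
      (𝓝 (sieveMap x q (sieveLim x z₀ s))) := by
    simp only [sieveIter_succ]
    exact ((continuous_sieveMap x q).tendsto _).comp hs
  exact ((tendsto_add_atTop_iff_nat 1).1 h1).limsup_eq

theorem ofReal_abs_sub_rpow_le {p : ℝ} (hp0 : 0 < p) (hp1 : p ≤ 1) (x y : ℝ) :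
    ENNReal.ofReal (|x - y| ^ p) ≤ ENNReal.ofReal (|x| ^ p) + ENNReal.ofReal (|y| ^ p) := by
  rw [← ENNReal.ofReal_rpow_of_nonneg (abs_nonneg _) hp0.le,
    ← ENNReal.ofReal_rpow_of_nonneg (abs_nonneg _) hp0.le,
    ← ENNReal.ofReal_rpow_of_nonneg (abs_nonneg _) hp0.le]
  refine le_trans (ENNReal.rpow_le_rpow ?_ hp0.le) (ENNReal.rpow_add_le_add_rpow _ _ hp0.le hp1)
  rw [← ENNReal.ofReal_add (abs_nonneg _) (abs_nonneg _)]
  exact ENNReal.ofReal_le_ofReal (abs_sub x y)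

/-- The term `Φ * x` is absorbed into the left side, which requires `x` finite; the factor `θ` is
simply bounded by `1`. -/
theorem ENNReal.le_div_of_le_mul_add {x c θ Φ : ℝ≥0∞} (hx : x ≠ ∞) (hΦ : Φ < 1) (hθ : θ ≤ 1)
    (h : x ≤ θ * Φ * x + c) : x ≤ c / (1 - Φ) := by
  have h1 : 1 - Φ ≠ 0 := (tsub_pos_of_lt hΦ).ne'
  rw [ENNReal.le_div_iff_mul_le (Or.inl h1)
    (Or.inl (tsub_le_self.trans_lt ENNReal.one_lt_top).ne)]
  have h2 : Φ * x ≠ ∞ := ENNReal.mul_ne_top (hΦ.trans ENNReal.one_lt_top).ne hx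
  have h3 : x ≤ Φ * x + c := h.trans (by
    gcongr
    exact mul_le_of_le_one_left' hθ)
  rw [mul_comm, ENNReal.sub_mul (fun _ _ => hx), one_mul]
  exact tsub_le_iff_left.2 h3

section Increment

variable {ν : Measure LipFun} [IsProbabilityMeasure ν] {p z₀ : ℝ}

theorem measurable_ofReal_abs_rpow (p : ℝ) : Measurable fun x : ℝ => ENNReal.ofReal (|x| ^ p) :=
  ((continuous_abs.measurable).pow_const p).ennreal_ofReal

/-- Conditioning on the first mark of the strip of width `v` yields a linear inequality for the
increment moment, which is then solved. -/
theorem lintegral_increment_le (hp0 : 0 < p) (hp1 : p ≤ 1)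
    (hΦ : lipMoment ν p < 1) (hν : ∫⁻ f : LipFun, ENNReal.ofReal |f z₀ - z₀| ∂ν < ∞)
    {u v : ℝ} (hu : 0 < u) (huv : u ≤ v) {I : ℝ≥0∞} (hI : I < ∞)
    (hIu : ∫⁻ s, ENNReal.ofReal (|sieveLim u z₀ s| ^ p) ∂(seqLaw v ν) ≤ I)
    (hIv : ∫⁻ s, ENNReal.ofReal (|sieveLim v z₀ s| ^ p) ∂(seqLaw v ν) ≤ I) :
    ∫⁻ s, ENNReal.ofReal (|sieveLim v z₀ s - sieveLim u z₀ s| ^ p) ∂(seqLaw v ν) ≤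
      ENNReal.ofReal (1 - u / v) * (2 * I) / (1 - lipMoment ν p) := by
  have hv : 0 < v := hu.trans_le huv
  have := isProbabilityMeasure_markLaw (ν := ν) hv
  have := isProbabilityMeasure_seqLaw (ν := ν) hv
  have hmu := measurable_sieveLim u z₀
  have hmv := measurable_sieveLim v z₀
  have hmp := measurable_ofReal_abs_rpow p
  have hHu : Measurable fun s => ENNReal.ofReal (|sieveLim u z₀ s| ^ p) := hmp.comp hmu
  have hHv : Measurable fun s => ENNReal.ofReal (|sieveLim v z₀ s| ^ p) := hmp.comp hmv
  set e := ∫⁻ s, ENNReal.ofReal (|sieveLim v z₀ s - sieveLim u z₀ s| ^ p) ∂(seqLaw v ν) with he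
  set eu := ∫⁻ s, ENNReal.ofReal (|sieveLim u z₀ s| ^ p) ∂(seqLaw v ν) with heu
  set ev := ∫⁻ s, ENNReal.ofReal (|sieveLim v z₀ s| ^ p) ∂(seqLaw v ν) with hev
  -- A priori finiteness, needed to absorb the `e` on the right of `hrec`.
  have hefin : e ≠ ∞ := by
    refine ((lintegral_mono fun s => ofReal_abs_sub_rpow_le hp0 hp1 _ _).trans_lt ?_).ne
    rw [lintegral_add_left hHv]
    exact ENNReal.add_lt_top.2 ⟨hIv.trans_lt hI, hIu.trans_lt hI⟩
  have hconv := ae_tendsto_sieveIter (X := v) hv hp0 hp1 hΦ hν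
  set K : LipFun → ℝ≥0∞ := fun f => ∫⁻ s, ENNReal.ofReal (|f (sieveLim v z₀ s)| ^ p) ∂(seqLaw v ν)
    with hK
  have hmK' : Measurable fun r : LipFun × (ℕ → ℝ × LipFun) =>
      ENNReal.ofReal (|r.1 (sieveLim v z₀ r.2)| ^ p) :=
    hmp.comp (measurable_lipFun_eval.comp (measurable_fst.prodMk (hmv.comp measurable_snd)))
  have hmK : Measurable K := hmK'.lintegral_prod_right'
  -- Stationarity: at level `v` no mark of the strip is dropped, so applying an independent `f` to
  -- the limit reproduces its law.
  have hKint : ∫⁻ f, K f ∂ν = ev := by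
    have h1 := lintegral_markLaw_indicator (X := v) (ν := ν) MeasurableSet.univ hmK
    have := isProbabilityMeasure_unifLaw hv
    simp only [Set.indicator_univ, Pi.one_apply, one_mul, measure_univ] at h1
    rw [← h1, hev, seqLaw, lintegral_infinitePi_cons _ hHv]
    refine lintegral_congr_ae ?_
    filter_upwards [ae_markLaw_le hv ν] with q hq
    refine lintegral_congr_ae ?_
    filter_upwards [hconv] with s hs
    rw [sieveLim_cons q (hs v hv le_rfl).1, sieveMap, if_pos hq]
  have hmH : Measurable fun s => ENNReal.ofReal (|sieveLim v z₀ s - sieveLim u z₀ s| ^ p) :=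
    hmp.comp (hmv.sub hmu)
  have hmL := measurable_lipConst_rpow p
  have hind : ∀ B : Set ℝ, MeasurableSet B →
      Measurable fun q : ℝ × LipFun => B.indicator (1 : ℝ → ℝ≥0∞) q.1 := fun B hB =>
    (measurable_one.indicator hB).comp measurable_fst
  -- Position and function of a mark are independent, so the probabilities `u / v` and `1 - u / v`
  -- factor out of the two cases.
  have hrec : e ≤ ENNReal.ofReal (u / v) * lipMoment ν p * e +
      ENNReal.ofReal (1 - u / v) * (2 * I) := by
    calc e = ∫⁻ q, ∫⁻ s, ENNReal.ofReal (|sieveLim v z₀ (fun n => Nat.casesOn n q s) -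
            sieveLim u z₀ (fun n => Nat.casesOn n q s)| ^ p) ∂(seqLaw v ν) ∂(markLaw v ν) := by
          rw [he, seqLaw, lintegral_infinitePi_cons _ hmH]
      _ ≤ ∫⁻ q, ((Set.Iic u).indicator 1 q.1 * (ENNReal.ofReal (lipConst q.2 ^ p) * e) +
            (Set.Ioi u).indicator 1 q.1 * (K q.2 + eu)) ∂(markLaw v ν) := by
          refine lintegral_mono_ae ?_
          filter_upwards [ae_markLaw_le hv ν] with q hq
          by_cases h1 : q.1 ≤ u
          · rw [Set.indicator_of_mem (show q.1 ∈ Set.Iic u from h1), Set.indicator_of_notMem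
              (show q.1 ∉ Set.Ioi u from not_lt.2 h1), Pi.one_apply, one_mul, zero_mul, add_zero,
              he, ← lintegral_const_mul _ hmH]
            refine lintegral_mono_ae ?_
            filter_upwards [hconv] with s hs
            rw [sieveLim_cons q (hs v hv le_rfl).1, sieveLim_cons q (hs u hu huv).1, sieveMap,
              sieveMap, if_pos hq, if_pos h1, ← ENNReal.ofReal_mul (Real.rpow_nonneg
              (lipConst_nonneg _) _), ← Real.mul_rpow (lipConst_nonneg _) (abs_nonneg _)]
            refine ENNReal.ofReal_le_ofReal (Real.rpow_le_rpow (abs_nonneg _) ?_ hp0.le)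
            rw [abs_sub_comm (sieveLim v z₀ s)]
            exact abs_sub_le_lipConst _ _ _
          · rw [Set.indicator_of_notMem (show q.1 ∉ Set.Iic u from h1), Set.indicator_of_mem
              (show q.1 ∈ Set.Ioi u from not_le.1 h1), Pi.one_apply, one_mul, zero_mul, zero_add,
              heu]
            refine le_trans (lintegral_mono_ae ?_) (lintegral_add_right _ hHu).le
            filter_upwards [hconv] with s hs
            rw [sieveLim_cons q (hs v hv le_rfl).1, sieveLim_cons q (hs u hu huv).1, sieveMap,
              sieveMap, if_pos hq, if_neg h1]
            exact ofReal_abs_sub_rpow_le hp0 hp1 _ _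
      _ = ENNReal.ofReal (u / v) * (lipMoment ν p * e) + ENNReal.ofReal (1 - u / v) * (ev + eu) := by
          have hmeas : Measurable fun q : ℝ × LipFun => (Set.Iic u).indicator (1 : ℝ → ℝ≥0∞) q.1 *
              (ENNReal.ofReal (lipConst q.2 ^ p) * e) :=
            (hind _ measurableSet_Iic).mul ((hmL.mul_const e).comp measurable_snd)
          rw [lintegral_add_left hmeas,
            lintegral_markLaw_indicator measurableSet_Iic (hmL.mul_const e),
            lintegral_markLaw_indicator measurableSet_Ioi (hmK.add_const eu),
            unifLaw_Iic hv huv, unifLaw_Ioi hv hu.le huv, lintegral_mul_const _ hmL,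
            lintegral_add_left hmK, hKint, lintegral_const, measure_univ, mul_one]
          rfl
      _ ≤ _ := by
          rw [mul_assoc, two_mul]
          gcongr
  refine ENNReal.le_div_of_le_mul_add hefin hΦ ?_ hrec
  rw [← ENNReal.ofReal_one]
  exact ENNReal.ofReal_le_ofReal ((div_le_one hv).2 huv)

end Increment

/-! ### The backward limit -/

section BackwardLimit

variable {ν : Measure LipFun} [IsProbabilityMeasure ν] {p z₀ : ℝ}

theorem map_snd_seqLaw {X : ℝ} (hX : 0 < X) :
    (seqLaw X ν).map (fun s i => (s i).2) = Measure.infinitePi fun _ : ℕ => ν := by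
  have := isProbabilityMeasure_unifLaw hX
  have := isProbabilityMeasure_markLaw (ν := ν) hX
  have h := Measure.infinitePi_map_pi (fun _ : ℕ => markLaw X ν)
    (f := fun (_ : ℕ) (q : ℝ × LipFun) => q.2) (fun _ => measurable_snd)
  have h2 : (markLaw X ν).map (fun q => q.2) = ν := by
    have := Measure.map_snd_prod (μ := unifLaw X) (ν := ν)
    rw [measure_univ, one_smul] at this
    exact this
  simp only [h2] at h
  exact h

theorem ae_sieveIter_eq_backwardIter {X : ℝ} (hX : 0 < X) (z₀ : ℝ) :
    ∀ᵐ s ∂(seqLaw X ν), sieveIter X z₀ s = backwardIter (fun i => (s i).2) z₀ := by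
  have := isProbabilityMeasure_markLaw (ν := ν) hX
  have h : ∀ᵐ s ∂(seqLaw X ν), ∀ i, (s i).1 ≤ X := ae_all_iff.2 fun i =>
    (measurePreserving_eval_infinitePi (fun _ : ℕ => markLaw X ν) i).quasiMeasurePreserving.ae
      (ae_markLaw_le hX ν)
  filter_upwards [h] with s hs
  funext n
  rw [backwardIter_eq_backComp, sieveIter]
  congr 1
  funext i z
  rw [sieveMap, if_pos (hs i)]

theorem ae_tendsto_backwardIter (hp0 : 0 < p) (hp1 : p ≤ 1)
    (hΦ : lipMoment ν p < 1) (hν : ∫⁻ f : LipFun, ENNReal.ofReal |f z₀ - z₀| ∂ν < ∞) :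
    ∀ᵐ f ∂(Measure.infinitePi fun _ : ℕ => ν), ∃ z, Tendsto (backwardIter f z₀) atTop (𝓝 z) := by
  rw [← map_snd_seqLaw (ν := ν) one_pos]
  have hm : Measurable fun (s : ℕ → ℝ × LipFun) (i : ℕ) => (s i).2 :=
    measurable_pi_lambda _ fun i => measurable_snd.comp (measurable_pi_apply i)
  refine (ae_map_iff hm.aemeasurable
    (measurableSet_exists_tendsto fun n => measurable_backwardIter z₀ n)).2 ?_
  filter_upwards [ae_tendsto_sieveIter one_pos hp0 hp1 hΦ hν,
    ae_sieveIter_eq_backwardIter (ν := ν) one_pos z₀] with s h1 h2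
  have h3 := (h1 1 one_pos le_rfl).1
  rw [h2] at h3
  exact ⟨_, h3⟩

theorem measurable_limsup_backwardIter (z₀ : ℝ) :
    Measurable fun f : ℕ → LipFun => limsup (backwardIter f z₀) atTop :=
  Measurable.limsup fun n => measurable_backwardIter z₀ n

/-- Sieving at the full width removes nothing, so the limit has the law of `Z_∞`, whatever `X` is.
-/
theorem lintegral_sieveLim_rpow_eq {X : ℝ} (hX : 0 < X) :
    ∫⁻ s, ENNReal.ofReal (|sieveLim X z₀ s| ^ p) ∂(seqLaw X ν) =
      ∫⁻ f, ENNReal.ofReal (|limsup (backwardIter f z₀) atTop| ^ p)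
        ∂(Measure.infinitePi fun _ : ℕ => ν) := by
  have hm : Measurable fun (s : ℕ → ℝ × LipFun) (i : ℕ) => (s i).2 :=
    measurable_pi_lambda _ fun i => measurable_snd.comp (measurable_pi_apply i)
  have hm' : Measurable fun f : ℕ → LipFun =>
      ENNReal.ofReal (|limsup (backwardIter f z₀) atTop| ^ p) :=
    (measurable_ofReal_abs_rpow p).comp (measurable_limsup_backwardIter z₀)
  rw [← map_snd_seqLaw (ν := ν) hX, lintegral_map hm' hm]
  refine lintegral_congr_ae ?_
  filter_upwards [ae_sieveIter_eq_backwardIter (ν := ν) hX z₀] with s hs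
  rw [sieveLim, hs]

end BackwardLimit

/-! ### Variation along uniform grids -/

/-- The `i`-th point of the grid that divides `[a, b]` into `N` equal parts. -/
def gridPoint (a b : ℝ) (N i : ℕ) : ℝ := a + (b - a) * ((min i N : ℕ) / N : ℝ)

/-- The variation of order `p` along the grid that divides `[a, b]` into `N` equal parts. -/
def gridVariation (p : ℝ) (g : ℝ → ℝ) (a b : ℝ) (N : ℕ) : ℝ≥0∞ :=
  ∑ i ∈ Finset.range N,
    ENNReal.ofReal (|g (gridPoint a b N (i + 1)) - g (gridPoint a b N i)| ^ p)

section Grid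

variable {a b : ℝ} {N : ℕ}

theorem gridPoint_mono (hab : a ≤ b) (N : ℕ) : Monotone (gridPoint a b N) := by
  intro i j hij
  unfold gridPoint
  have : min i N ≤ min j N := min_le_min_right N hij
  have h0 : 0 ≤ b - a := sub_nonneg.2 hab
  gcongr

theorem gridPoint_zero : gridPoint a b N 0 = a := by simp [gridPoint]

theorem gridPoint_self (hN : N ≠ 0) : gridPoint a b N N = b := by
  have : (N : ℝ) ≠ 0 := Nat.cast_ne_zero.2 hN
  simp [gridPoint, this]

theorem gridPoint_mem (hab : a ≤ b) (i : ℕ) : gridPoint a b N i ∈ Set.Icc a b := by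
  unfold gridPoint
  have h0 : 0 ≤ b - a := sub_nonneg.2 hab
  have h1 : ((min i N : ℕ) / N : ℝ) ≤ 1 := div_le_one_of_le₀ (by exact_mod_cast min_le_right i N)
    (Nat.cast_nonneg N)
  have h2 : (0 : ℝ) ≤ ((min i N : ℕ) / N : ℝ) := by positivity
  constructor <;> nlinarith

/-- The index of the first grid point at or after `x`. -/
def gridIndex (a b : ℝ) (N : ℕ) (x : ℝ) : ℕ := ⌈(x - a) / (b - a) * N⌉₊

theorem gridIndex_mono (hab : a ≤ b) (N : ℕ) : Monotone (gridIndex a b N) := by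
  intro x y hxy
  unfold gridIndex
  have h0 : 0 ≤ b - a := sub_nonneg.2 hab
  gcongr

theorem gridIndex_le {x : ℝ} (hx : x ∈ Set.Icc a b) : gridIndex a b N x ≤ N := by
  refine Nat.ceil_le.2 (mul_le_of_le_one_left (Nat.cast_nonneg N) ?_)
  exact div_le_one_of_le₀ (by linarith [hx.2]) (by linarith [hx.1, hx.2])

theorem gridPoint_gridIndex_mem (hN : N ≠ 0) {x : ℝ} (hx : x ∈ Set.Icc a b) :
    gridPoint a b N (gridIndex a b N x) ∈ Set.Icc x (x + (b - a) / N) := by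
  have hN' : (0 : ℝ) < N := by positivity
  have hab : 0 ≤ b - a := by linarith [hx.1, hx.2]
  set c := (x - a) / (b - a) with hc
  have hc0 : 0 ≤ c := div_nonneg (by linarith [hx.1]) hab
  have hxc : (b - a) * c = x - a := by
    -- When `a = b`, the quotient `c` takes the default value of division by zero, but `x = a` makes
    -- the identity trivial.
    rcases eq_or_lt_of_le hab with h | h
    · rw [← h, zero_mul]; linarith [hx.1, hx.2]
    · rw [hc]; field_simp
  rw [gridPoint, min_eq_left (gridIndex_le hx)]
  have h1 : c * N ≤ gridIndex a b N x := Nat.le_ceil _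
  have h2 : (gridIndex a b N x : ℝ) < c * N + 1 := Nat.ceil_lt_add_one (by positivity)
  have h3 : c ≤ gridIndex a b N x / N := (le_div_iff₀ hN').2 h1
  have h4 : (gridIndex a b N x : ℝ) / N ≤ c + 1 / N := by
    rw [div_le_iff₀ hN', add_mul, one_div_mul_cancel hN'.ne']
    exact h2.le
  constructor
  · nlinarith [mul_le_mul_of_nonneg_left h3 hab]
  · have := mul_le_mul_of_nonneg_left h4 hab
    rw [mul_add, mul_one_div] at this
    linarith

theorem ofReal_abs_sub_rpow_le_sum {p : ℝ} (hp0 : 0 < p) (hp1 : p ≤ 1) (h : ℕ → ℝ) {k l : ℕ}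
    (hkl : k ≤ l) : ENNReal.ofReal (|h l - h k| ^ p) ≤
      ∑ j ∈ Finset.Ico k l, ENNReal.ofReal (|h (j + 1) - h j| ^ p) := by
  induction l, hkl using Nat.le_induction with
  | base => simp [hp0.ne']
  | succ l hkl ih =>
    rw [Finset.sum_Ico_succ_top hkl]
    have := ofReal_abs_sub_rpow_le hp0 hp1 (h (l + 1) - h l) (h k - h l)
    rw [sub_sub_sub_cancel_right, abs_sub_comm (h k)] at this
    exact (this.trans (add_le_add le_rfl ih)).trans (add_comm _ _).le

/-- The truncation `min i N` makes the grid an admissible infinite sequence in `[a, b]`. -/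
theorem gridVariation_le_pVariation (p : ℝ) (g : ℝ → ℝ) (hab : a ≤ b) (N : ℕ) :
    gridVariation p g a b N ≤ pVariation p g a b :=
  le_iSup (fun q : ℕ × {u : ℕ → ℝ // Monotone u ∧ ∀ i, u i ∈ Set.Icc a b} =>
    ∑ i ∈ Finset.range q.1, ENNReal.ofReal (|g (q.2.1 (i + 1)) - g (q.2.1 i)| ^ p))
    (N, ⟨gridPoint a b N, gridPoint_mono hab N, gridPoint_mem hab⟩)

/-- Rounding a partition up to the grid gives a coarsening of part of the grid, and for `p ≤ 1`
coarsening cannot increase the sum. -/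
theorem sum_gridIndex_le_gridVariation {p : ℝ} (hp0 : 0 < p) (hp1 : p ≤ 1) (g : ℝ → ℝ)
    (hab : a ≤ b) (N : ℕ) {u : ℕ → ℝ} (hu : Monotone u) (hmem : ∀ i, u i ∈ Set.Icc a b) (m : ℕ) :
    ∑ i ∈ Finset.range m, ENNReal.ofReal (|g (gridPoint a b N (gridIndex a b N (u (i + 1)))) -
      g (gridPoint a b N (gridIndex a b N (u i)))| ^ p) ≤ gridVariation p g a b N := by
  set k : ℕ → ℕ := fun i => gridIndex a b N (u i) with hk
  have hkm : Monotone k := (gridIndex_mono hab N).comp hu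
  set d : ℕ → ℝ≥0∞ := fun j =>
    ENNReal.ofReal (|g (gridPoint a b N (j + 1)) - g (gridPoint a b N j)| ^ p) with hd
  have hsum : ∀ m, ∑ i ∈ Finset.range m, ∑ j ∈ Finset.Ico (k i) (k (i + 1)), d j =
      ∑ j ∈ Finset.Ico (k 0) (k m), d j := by
    intro m
    induction m with
    | zero => simp
    | succ m ih =>
      rw [Finset.sum_range_succ, ih, Finset.sum_Ico_consecutive _ (hkm (Nat.zero_le m))
        (hkm (Nat.le_succ m))]
  calc _ ≤ ∑ i ∈ Finset.range m, ∑ j ∈ Finset.Ico (k i) (k (i + 1)), d j :=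
        Finset.sum_le_sum fun i _ => ofReal_abs_sub_rpow_le_sum hp0 hp1
          (fun j => g (gridPoint a b N j)) (hkm (Nat.le_succ i))
    _ = ∑ j ∈ Finset.Ico (k 0) (k m), d j := hsum m
    _ ≤ ∑ j ∈ Finset.range N, d j := by
        refine Finset.sum_le_sum_of_subset fun j hj => Finset.mem_range.2 ?_
        exact (Finset.mem_Ico.1 hj).2.trans_le (gridIndex_le (hmem m))

/-- Grid points rounded up approach from the right, so right-continuity recovers the sum over any
partition. An uncountable supremum becomes a countable limit operation. -/
theorem pVariation_eq_liminf {p : ℝ} (hp0 : 0 < p) (hp1 : p ≤ 1) {g : ℝ → ℝ} (hab : a ≤ b)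
    (hg : ∀ x ∈ Set.Icc a b, ContinuousWithinAt g (Set.Icc x b) x) :
    pVariation p g a b = liminf (fun n => gridVariation p g a b (n + 1)) atTop := by
  refine le_antisymm (iSup_le ?_) ?_
  · rintro ⟨m, u, hu, hmem⟩
    have hlim : ∀ x ∈ Set.Icc a b, Tendsto
        (fun n : ℕ => g (gridPoint a b (n + 1) (gridIndex a b (n + 1) x))) atTop (𝓝 (g x)) := by
      intro x hx
      refine (hg x hx).tendsto.comp (tendsto_nhdsWithin_iff.2 ⟨?_, Eventually.of_forall fun n => ?_⟩)
      · have h1 : Tendsto (fun n : ℕ => x + (b - a) / ((n + 1 : ℕ) : ℝ)) atTop (𝓝 (x + 0)) :=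
          tendsto_const_nhds.add (((tendsto_const_div_atTop_nhds_zero_nat (b - a))).comp
            (tendsto_add_atTop_nat 1))
        rw [add_zero] at h1
        exact tendsto_of_tendsto_of_tendsto_of_le_of_le tendsto_const_nhds h1
          (fun n => (gridPoint_gridIndex_mem n.succ_ne_zero hx).1)
          (fun n => (gridPoint_gridIndex_mem n.succ_ne_zero hx).2)
      · exact ⟨(gridPoint_gridIndex_mem n.succ_ne_zero hx).1, (gridPoint_mem hab _).2⟩
    have hS : Tendsto (fun n : ℕ => ∑ i ∈ Finset.range m, ENNReal.ofReal
        (|g (gridPoint a b (n + 1) (gridIndex a b (n + 1) (u (i + 1)))) -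
          g (gridPoint a b (n + 1) (gridIndex a b (n + 1) (u i)))| ^ p)) atTop
        (𝓝 (∑ i ∈ Finset.range m, ENNReal.ofReal (|g (u (i + 1)) - g (u i)| ^ p))) := by
      refine tendsto_finsetSum _ fun i _ => ENNReal.tendsto_ofReal ?_
      exact ((hlim _ (hmem _)).sub (hlim _ (hmem _))).abs.rpow_const (Or.inr hp0.le)
    rw [← hS.liminf_eq]
    exact liminf_le_liminf (Eventually.of_forall fun n =>
      sum_gridIndex_le_gridVariation hp0 hp1 g hab (n + 1) hu hmem m)
  · refine (liminf_le_liminf (Eventually.of_forall fun n =>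
      gridVariation_le_pVariation p g hab (n + 1))).trans (le_of_eq ?_)
    exact liminf_const _

/-- The bound `1 - 1/r ≤ log r`, applied to ratios of neighbouring grid points, telescopes. -/
theorem sum_one_sub_div_le_log (ha : 0 < a) (hab : a ≤ b) (hN : N ≠ 0) :
    ∑ i ∈ Finset.range N, ENNReal.ofReal (1 - gridPoint a b N i / gridPoint a b N (i + 1)) ≤
      ENNReal.ofReal (Real.log (b / a)) := by
  have hpos : ∀ i, 0 < gridPoint a b N i := fun i => ha.trans_le (gridPoint_mem hab i).1
  have hle : ∀ i, 1 - gridPoint a b N i / gridPoint a b N (i + 1) ≤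
      Real.log (gridPoint a b N (i + 1)) - Real.log (gridPoint a b N i) := by
    intro i
    rw [← Real.log_div (hpos _).ne' (hpos _).ne', ← inv_div]
    exact Real.one_sub_inv_le_log_of_pos (div_pos (hpos _) (hpos _))
  calc _ ≤ ∑ i ∈ Finset.range N, ENNReal.ofReal
          (Real.log (gridPoint a b N (i + 1)) - Real.log (gridPoint a b N i)) :=
        Finset.sum_le_sum fun i _ => ENNReal.ofReal_le_ofReal (hle i)
    _ = ENNReal.ofReal (Real.log (b / a)) := by
        rw [← ENNReal.ofReal_sum_of_nonneg fun i _ => sub_nonneg.2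
          (Real.log_le_log (hpos i) (gridPoint_mono hab N (Nat.le_succ i))),
          Finset.sum_range_sub fun i => Real.log (gridPoint a b N i), gridPoint_zero,
          gridPoint_self hN, Real.log_div (ha.trans_le hab).ne' ha.ne']

end Grid

/-! ### The sieved process -/

section SievedProcess

variable {Ω : Type*} [MeasurableSpace Ω] {P : Measure Ω} [IsProbabilityMeasure P]
  {ν : Measure LipFun} [IsProbabilityMeasure ν] {z₀ p : ℝ} {Y : ℕ → Ω → ℝ × ℝ × LipFun}

/-- The marks of the points with positions in `[0, X]`, in the order of time. -/
def stripMarks (Y : ℕ → Ω → ℝ × ℝ × LipFun) (X : ℝ) (ω : Ω) (n : ℕ) : ℝ × LipFun :=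
  rankMark (fun k => Y k ω) (Set.Icc 0 X ×ˢ Set.univ) n

theorem measurable_stripMarks (hY : ∀ k, Measurable (Y k)) (X : ℝ) :
    Measurable (stripMarks Y X) :=
  measurable_pi_lambda _ fun n =>
    measurable_rankMark hY (measurableSet_Icc.prod MeasurableSet.univ) n

theorem prod_strip (ν : Measure LipFun) [IsProbabilityMeasure ν] (X : ℝ) :
    (lebHalfLine.prod ν) (Set.Icc 0 X ×ˢ Set.univ) = ENNReal.ofReal X := by
  rw [Measure.prod_prod, measure_univ, mul_one,
    lebHalfLine_apply_of_subset Set.Icc_subset_Ici_self, Real.volume_Icc, sub_zero]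

theorem map_stripMarks (hY : IsPoissonProcess Y (lebHalfLine.prod (lebHalfLine.prod ν)) P)
    {X : ℝ} (hX : 0 < X) : P.map (stripMarks Y X) = seqLaw X ν := by
  have h := hY.map_rankMark (S := Set.Icc 0 X ×ˢ Set.univ)
    (measurableSet_Icc.prod MeasurableSet.univ)
    (by rw [prod_strip]; exact (ENNReal.ofReal_pos.2 hX).ne')
    (by rw [prod_strip]; exact ENNReal.ofReal_lt_top)
  rw [cond_eq_markLaw] at h
  exact h

theorem ae_tendsto_sievedIter
    (hY : IsPoissonProcess Y (lebHalfLine.prod (lebHalfLine.prod ν)) P)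
    (hp0 : 0 < p) (hp1 : p ≤ 1) (hΦ : lipMoment ν p < 1)
    (hν : ∫⁻ f : LipFun, ENNReal.ofReal |f z₀ - z₀| ∂ν < ∞) {X : ℝ} (hX : 0 < X) :
    ∀ᵐ ω ∂P, ∀ x, 0 < x → x ≤ X →
      Tendsto (sievedIter (fun k => Y k ω) z₀ (Set.Icc 0 x)) atTop
        (𝓝 (sieveLim x z₀ (stripMarks Y X ω))) ∧
      ContinuousWithinAt (fun y => sieveLim y z₀ (stripMarks Y X ω)) (Set.Icc x X) x := by
  have hS : MeasurableSet (Set.Icc 0 X ×ˢ (Set.univ : Set LipFun)) :=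
    measurableSet_Icc.prod MeasurableSet.univ
  have hfin : (lebHalfLine.prod ν) (Set.Icc 0 X ×ˢ Set.univ) < ∞ := by
    rw [prod_strip]; exact ENNReal.ofReal_lt_top
  have h1 := ae_tendsto_sieveIter (ν := ν) hX hp0 hp1 hΦ hν
  rw [← map_stripMarks hY hX] at h1
  filter_upwards [ae_of_ae_map (measurable_stripMarks hY.measurable X).aemeasurable h1,
    hY.ae_existsUnique_hasRank hS (by rw [prod_strip]; exact (ENNReal.ofReal_pos.2 hX).ne') hfin,
    hY.ae_finite hS hfin] with ω h2 h3 h4 x hx hxX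
  obtain ⟨N, hN, hiter⟩ := exists_sievedIter_eq h3 h4
  refine ⟨?_, (h2 x hx hxX).2⟩
  exact ((h2 x hx hxX).1.comp hN).congr fun t => (hiter x hxX z₀ t).symm

theorem ae_zetaProcess_eq
    (hY : IsPoissonProcess Y (lebHalfLine.prod (lebHalfLine.prod ν)) P)
    (hp0 : 0 < p) (hp1 : p ≤ 1) (hΦ : lipMoment ν p < 1)
    (hν : ∫⁻ f : LipFun, ENNReal.ofReal |f z₀ - z₀| ∂ν < ∞) {X : ℝ} (hX : 0 < X) :
    ∀ᵐ ω ∂P, ∀ x, 0 < x → x ≤ X →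
      zetaProcess (fun k => Y k ω) z₀ x = sieveLim x z₀ (stripMarks Y X ω) := by
  filter_upwards [ae_tendsto_sievedIter hY hp0 hp1 hΦ hν hX] with ω h x hx hxX
  exact (h x hx hxX).1.limUnder_eq

theorem ae_tendsto_zetaProcess
    (hY : IsPoissonProcess Y (lebHalfLine.prod (lebHalfLine.prod ν)) P)
    (hp0 : 0 < p) (hp1 : p ≤ 1) (hΦ : lipMoment ν p < 1)
    (hν : ∫⁻ f : LipFun, ENNReal.ofReal |f z₀ - z₀| ∂ν < ∞) :
    ∀ᵐ ω ∂P, ∀ x, 0 < x → Tendsto (sievedIter (fun k => Y k ω) z₀ (Set.Icc 0 x)) atTop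
      (𝓝 (zetaProcess (fun k => Y k ω) z₀ x)) := by
  have h := ae_all_iff.2 fun n : ℕ =>
    ae_tendsto_sievedIter hY hp0 hp1 hΦ hν (X := (n : ℝ) + 1) (by positivity)
  filter_upwards [h] with ω h x hx
  obtain ⟨n, hn⟩ := exists_nat_ge x
  exact tendsto_nhds_limUnder ⟨_, (h n x hx (by linarith)).1⟩

theorem ae_continuousWithinAt_zetaProcess
    (hY : IsPoissonProcess Y (lebHalfLine.prod (lebHalfLine.prod ν)) P)
    (hp0 : 0 < p) (hp1 : p ≤ 1) (hΦ : lipMoment ν p < 1)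
    (hν : ∫⁻ f : LipFun, ENNReal.ofReal |f z₀ - z₀| ∂ν < ∞) {X : ℝ} (hX : 0 < X) :
    ∀ᵐ ω ∂P, ∀ x, 0 < x → x ≤ X →
      ContinuousWithinAt (zetaProcess (fun k => Y k ω) z₀) (Set.Icc x X) x := by
  filter_upwards [ae_tendsto_sievedIter hY hp0 hp1 hΦ hν hX,
    ae_zetaProcess_eq hY hp0 hp1 hΦ hν hX] with ω h1 h2 x hx hxX
  exact (h1 x hx hxX).2.congr (fun y hy => h2 y (hx.trans_le hy.1) hy.2) (h2 x hx hxX)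

theorem aemeasurable_zetaProcess
    (hY : IsPoissonProcess Y (lebHalfLine.prod (lebHalfLine.prod ν)) P)
    (hp0 : 0 < p) (hp1 : p ≤ 1) (hΦ : lipMoment ν p < 1)
    (hν : ∫⁻ f : LipFun, ENNReal.ofReal |f z₀ - z₀| ∂ν < ∞) {x : ℝ} (hx : 0 < x) :
    AEMeasurable (fun ω => zetaProcess (fun k => Y k ω) z₀ x) P := by
  refine ⟨_, (measurable_sieveLim x z₀).comp (measurable_stripMarks hY.measurable x), ?_⟩
  filter_upwards [ae_zetaProcess_eq hY hp0 hp1 hΦ hν hx] with ω h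
  exact h x hx le_rfl

theorem lintegral_comp_stripMarks
    (hY : IsPoissonProcess Y (lebHalfLine.prod (lebHalfLine.prod ν)) P) {X : ℝ} (hX : 0 < X)
    {H : (ℕ → ℝ × LipFun) → ℝ≥0∞} (hH : Measurable H) :
    ∫⁻ ω, H (stripMarks Y X ω) ∂P = ∫⁻ s, H s ∂(seqLaw X ν) := by
  rw [← map_stripMarks hY hX, lintegral_map hH (measurable_stripMarks hY.measurable X)]

theorem lintegral_zetaProcess_increment_le
    (hY : IsPoissonProcess Y (lebHalfLine.prod (lebHalfLine.prod ν)) P)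
    (hp0 : 0 < p) (hp1 : p ≤ 1) (hΦ : lipMoment ν p < 1)
    (hν : ∫⁻ f : LipFun, ENNReal.ofReal |f z₀ - z₀| ∂ν < ∞) {u v : ℝ} (hu : 0 < u) (huv : u ≤ v) :
    ∫⁻ ω, ENNReal.ofReal (|(zetaProcess (fun k => Y k ω) z₀ v) -
      zetaProcess (fun k => Y k ω) z₀ u| ^ p) ∂P ≤
      ENNReal.ofReal (1 - u / v) * (2 * ∫⁻ f, ENNReal.ofReal (|limsup (backwardIter f z₀) atTop| ^ p)
        ∂(Measure.infinitePi fun _ : ℕ => ν)) / (1 - lipMoment ν p) := by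
  have hv := hu.trans_le huv
  have hm := measurable_ofReal_abs_rpow p
  have hHm : ∀ x, Measurable fun s => ENNReal.ofReal (|sieveLim x z₀ s| ^ p) := fun x =>
    hm.comp (measurable_sieveLim x z₀)
  have hDm : Measurable fun s => ENNReal.ofReal (|sieveLim v z₀ s - sieveLim u z₀ s| ^ p) :=
    hm.comp ((measurable_sieveLim v z₀).sub (measurable_sieveLim u z₀))
  have hzv := ae_zetaProcess_eq hY hp0 hp1 hΦ hν hv
  have hzu := ae_zetaProcess_eq hY hp0 hp1 hΦ hν hu
  have hIu : ∫⁻ s, ENNReal.ofReal (|sieveLim u z₀ s| ^ p) ∂(seqLaw v ν) =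
      ∫⁻ f, ENNReal.ofReal (|limsup (backwardIter f z₀) atTop| ^ p)
        ∂(Measure.infinitePi fun _ : ℕ => ν) := by
    -- The value at `u` read from the strip of width `v` is almost surely `ζ(u)`, hence equals the
    -- one read from the strip of width `u`, whose law is that of `Z_∞`.
    rw [← lintegral_sieveLim_rpow_eq hu, ← lintegral_comp_stripMarks hY hv (hHm u),
      ← lintegral_comp_stripMarks hY hu (hHm u)]
    refine lintegral_congr_ae ?_
    filter_upwards [hzv, hzu] with ω h1 h2
    rw [← h1 u hu huv, ← h2 u hu le_rfl]
  have hI := lintegral_sieveLim_rpow_lt_top (ν := ν) one_pos hp0 hp1 hΦ hν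
  rw [lintegral_sieveLim_rpow_eq one_pos] at hI
  refine le_trans (le_of_eq ?_) (lintegral_increment_le hp0 hp1 hΦ hν hu huv hI hIu.le
    (lintegral_sieveLim_rpow_eq hv).le)
  rw [← lintegral_comp_stripMarks hY hv hDm]
  refine lintegral_congr_ae ?_
  filter_upwards [hzv] with ω h1
  rw [h1 u hu huv, h1 v hv le_rfl]

end SievedProcess

end

/-! ### The main theorem -/

theorem mainTheorem8 {Ω Ω' : Type*} [MeasurableSpace Ω] [MeasurableSpace Ω']
    (P : Measure Ω) [IsProbabilityMeasure P] (P' : Measure Ω') [IsProbabilityMeasure P']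
    (ν : Measure LipFun) [IsProbabilityMeasure ν] (z₀ : ℝ) (hν : IsContractive ν z₀)
    -- the Poisson process with intensity `Leb ⊗ Leb ⊗ ν`
    (Y : ℕ → Ω → ℝ × ℝ × LipFun)
    (hY : IsPoissonProcess Y
      (lebHalfLine.prod (lebHalfLine.prod ν)) P)
    -- an i.i.d. sequence with distribution `ν`, used to define `Z_∞`
    (f : ℕ → Ω' → LipFun) (hf : ∀ n, Measurable (f n)) (hf_indep : iIndepFun f P')
    (hf_law : ∀ n, P'.map (f n) = ν)
    (p : ℝ) (hp0 : 0 < p) (hp1 : p ≤ 1) (hΦ : lipMoment ν p < 1)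
    (a b : ℝ) (ha : 0 < a) (hab : a ≤ b) :
    -- `Z_∞` and `(ζ(x))_{x > 0}` are almost surely well defined as limits
    (∀ᵐ ω ∂P', Tendsto (backwardIter (fun n => f n ω) z₀) atTop
      (𝓝 (backwardLimit (fun n => f n ω) z₀))) ∧
    (∀ᵐ ω ∂P, ∀ x : ℝ, 0 < x →
      Tendsto (sievedIter (fun k => Y k ω) z₀ (Set.Icc 0 x)) atTop
        (𝓝 (zetaProcess (fun k => Y k ω) z₀ x))) ∧
    -- `E |Z_∞| ^ p` is finite
    ∫⁻ ω, ENNReal.ofReal (|backwardLimit (fun n => f n ω) z₀| ^ p) ∂P' < ∞ ∧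
    -- the `p`-variation is a random variable, and its expectation is bounded
    AEMeasurable (fun ω => pVariation p (zetaProcess (fun k => Y k ω) z₀) a b) P ∧
    ∫⁻ ω, pVariation p (zetaProcess (fun k => Y k ω) z₀) a b ∂P ≤
      ENNReal.ofReal (Real.log (b / a)) *
        (2 * ∫⁻ ω, ENNReal.ofReal (|backwardLimit (fun n => f n ω) z₀| ^ p) ∂P') /
          (1 - lipMoment ν p) := by
  have hd := hν.displacement_lt_top
  have hseq : Measurable fun ω n => f n ω := measurable_pi_lambda _ hf
  have hlaw : P'.map (fun ω n => f n ω) = Measure.infinitePi fun _ : ℕ => ν := by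
    rw [hf_indep.map_fun_eq_infinitePi_map hf]
    simp only [hf_law]
  have hconv : ∀ᵐ ω ∂P', ∃ z, Tendsto (backwardIter (fun n => f n ω) z₀) atTop (𝓝 z) := by
    have h := ae_tendsto_backwardIter (ν := ν) hp0 hp1 hΦ hd
    rw [← hlaw] at h
    exact ae_of_ae_map hseq.aemeasurable h
  set I := ∫⁻ g, ENNReal.ofReal (|limsup (backwardIter g z₀) atTop| ^ p)
    ∂(Measure.infinitePi fun _ : ℕ => ν) with hI
  have hIeq : ∫⁻ ω, ENNReal.ofReal (|backwardLimit (fun n => f n ω) z₀| ^ p) ∂P' = I := by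
    have hm : Measurable fun g : ℕ → LipFun =>
        ENNReal.ofReal (|limsup (backwardIter g z₀) atTop| ^ p) :=
      (measurable_ofReal_abs_rpow p).comp (measurable_limsup_backwardIter z₀)
    rw [hI, ← hlaw, lintegral_map hm hseq]
    refine lintegral_congr_ae ?_
    filter_upwards [hconv] with ω hω
    obtain ⟨z, hz⟩ := hω
    rw [backwardLimit, hz.limUnder_eq, hz.limsup_eq]
  have hIfin : I < ∞ := by
    have h := lintegral_sieveLim_rpow_lt_top (ν := ν) one_pos hp0 hp1 hΦ hd
    rwa [lintegral_sieveLim_rpow_eq one_pos] at h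
  have hb := ha.trans_le hab
  have hV : ∀ᵐ ω ∂P, pVariation p (zetaProcess (fun k => Y k ω) z₀) a b =
      liminf (fun n => gridVariation p (zetaProcess (fun k => Y k ω) z₀) a b (n + 1)) atTop := by
    filter_upwards [ae_continuousWithinAt_zetaProcess hY hp0 hp1 hΦ hd hb] with ω h
    exact pVariation_eq_liminf hp0 hp1 hab fun x hx => h x (ha.trans_le hx.1) hx.2
  have hpos : ∀ N i, 0 < gridPoint a b N i := fun N i => ha.trans_le (gridPoint_mem hab i).1
  have hterm : ∀ N i, AEMeasurable (fun ω => ENNReal.ofReal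
      (|(zetaProcess (fun k => Y k ω) z₀ (gridPoint a b N (i + 1))) -
        zetaProcess (fun k => Y k ω) z₀ (gridPoint a b N i)| ^ p)) P := fun N i =>
    (measurable_ofReal_abs_rpow p).comp_aemeasurable
      ((aemeasurable_zetaProcess hY hp0 hp1 hΦ hd (hpos N (i + 1))).sub
        (aemeasurable_zetaProcess hY hp0 hp1 hΦ hd (hpos N i)))
  have hgrid : ∀ N, AEMeasurable
      (fun ω => gridVariation p (zetaProcess (fun k => Y k ω) z₀) a b N) P := fun N =>
    Finset.aemeasurable_fun_sum _ fun i _ => hterm N i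
  refine ⟨?_, ae_tendsto_zetaProcess hY hp0 hp1 hΦ hd, hIeq ▸ hIfin, ?_, ?_⟩
  · filter_upwards [hconv] with ω hω
    exact tendsto_nhds_limUnder hω
  · simp only [liminf_eq_iSup_iInf_of_nat'] at hV
    exact (AEMeasurable.iSup fun n => AEMeasurable.iInf fun i => hgrid (i + n + 1)).congr
      (hV.mono fun ω h => h.symm)
  · rw [hIeq, lintegral_congr_ae hV]
    -- Fatou's lemma reduces the claim to a bound for each grid, uniform in the mesh.
    refine (lintegral_liminf_le' fun n => hgrid (n + 1)).trans ?_
    -- An eventual lower bound `c` lies below the term of some grid, so bounding that single term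
    -- suffices.
    refine liminf_le_of_le (by isBoundedDefault) fun c hc => ?_
    obtain ⟨n, hn⟩ := hc.exists
    refine hn.trans ?_
    unfold gridVariation
    rw [lintegral_finsetSum' _ fun i _ => hterm (n + 1) i]
    calc _ ≤ ∑ i ∈ Finset.range (n + 1), ENNReal.ofReal
            (1 - gridPoint a b (n + 1) i / gridPoint a b (n + 1) (i + 1)) * (2 * I) /
            (1 - lipMoment ν p) := Finset.sum_le_sum fun i _ =>
          lintegral_zetaProcess_increment_le hY hp0 hp1 hΦ hd (hpos _ _)
            (gridPoint_mono hab _ (Nat.le_succ i))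
      _ ≤ _ := by
          simp only [div_eq_mul_inv (_ * _ : ℝ≥0∞), mul_assoc]
          rw [← Finset.sum_mul]
          gcongr
          exact sum_one_sub_div_le_log ha hab n.succ_ne_zero
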